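/- Let $K\subset\mathbb R^n$ be a symmetric convex body (compact, convex, nonempty interior, $K=-K$), and let $d\mu=e^{-V(x)}\,dx$ with $V:\mathbb R^n\to\mathbb R$ convex, even and twice differentiable. Write $\operatorname{avg} f=\frac1{\mu(K)}\int_K f\,d\mu$ and $Lw=\Delta w-\langle\nabla w,\nabla V\rangle$. Let $u:K\to\mathbb R$ be an even function in $W^{2,2}(K,\mu)\cap C^2(K)$, i.e. $u$ is $C^2$ in the interior of $K$ and $u,\nabla u,\nabla^2u$ are square integrable on $K$ with respect to $\mu$. Then $Lu$ and $LV$ are $\mu$-integrable on $K$, $\operatorname{avg} LV\ge 0$, and $$\operatorname{avg}\,\mathrm{tr}\big(\nabla^2u\,(\nabla^2V)^{-1}\,\nabla^2u\big)\;\ge\;\operatorname{avg}|\nabla u|^2+\frac{(\operatorname{avg} Lu)^2}{\operatorname{avg} LV},$$ as an inequality in $[0,\infty]$ with $0/0=0$ and $a/0=\infty$ for $a>0$. At points where $\nabla^2V$ is singular, $\mathrm{tr}(\nabla^2u(\nabla^2V)^{-1}\nabla^2u)$ denotes $\mathrm{tr}(\nabla^2u\,Z)$ for any matrix $Z$ with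 $\nabla^2V\,Z=\nabla^2u$ (the value does not depend on $Z$), and $+\infty$ if there is no such $Z$. -/

import Mathlib

open MeasureTheory Set
open scoped ENNReal Matrix Laplacian

noncomputable section

/-- Euclidean `n`-space. -/
abbrev Rn (n : ℕ) : Type := EuclideanSpace ℝ (Fin n)

/-- The measure `dμ = e^{-V} dx` on `ℝⁿ`. -/
def expMeasure {n : ℕ} (V : Rn n → ℝ) : Measure (Rn n) :=
  volume.withDensity fun x => ENNReal.ofReal (Real.exp (-V x))

/-- The Hessian matrix `∇²f (x) = (∂ᵢ∂ⱼ f (x))`. -/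
def hessianMatrix {n : ℕ} (f : Rn n → ℝ) (x : Rn n) : Matrix (Fin n) (Fin n) ℝ :=
  Matrix.of fun i j =>
    iteratedFDeriv ℝ 2 f x ![EuclideanSpace.single i 1, EuclideanSpace.single j 1]

/-- The operator `L u = Δ u - ⟨∇u, ∇V⟩` associated with the measure `e^{-V} dx`. -/
def opL {n : ℕ} (V u : Rn n → ℝ) (x : Rn n) : ℝ :=
  Δ u x - inner ℝ (gradient u x) (gradient V x)

/-- A symmetric convex body: a compact convex set with nonempty interior, invariant under
`x ↦ -x`. -/
structure IsSymmConvexBody {n : ℕ} (K : Set (Rn n)) : Prop where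
  convex : Convex ℝ K
  isCompact : IsCompact K
  interior_nonempty : (interior K).Nonempty
  neg_mem : ∀ x ∈ K, -x ∈ K

/-- Membership in `W^{2,2}(K, μ) ∩ C²(K)`: `u` is twice continuously differentiable in the interior
of `K`, and `u`, `∇u`, `∇²u` are square integrable on `K`. For such `u` the weak derivatives are the
classical ones. All measures `μ` below are absolutely continuous, so that the boundary of a convex
set `K`, where the derivatives need not exist, is a null set. -/
structure MemW22C2 {n : ℕ} (K : Set (Rn n)) (μ : Measure (Rn n)) (u : Rn n → ℝ) : Prop where
  contDiffOn : ContDiffOn ℝ 2 u (interior K)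
  memLp : MemLp u 2 (μ.restrict K)
  memLp_gradient : MemLp (gradient u) 2 (μ.restrict K)
  memLp_hessian : ∀ i j, MemLp (fun x => hessianMatrix u x i j) 2 (μ.restrict K)

/-- `tr (M A⁻¹ M)` in `[0, ∞]`, for `M` symmetric and `A` symmetric positive semidefinite. Here
`A⁻¹ M` stands for a solution `Z` of `A Z = M`; the value `tr (M Z) = tr (Zᵀ A Z) ≥ 0` does not
depend on which solution is taken, and it is `∞` if there is none. For invertible `A` this is the
usual trace, see `traceInv_eq_of_isUnit_det`. -/
def traceInv {n : ℕ} (M A : Matrix (Fin n) (Fin n) ℝ) : ℝ≥0∞ :=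
  ⨅ (Z : Matrix (Fin n) (Fin n) ℝ) (_ : A * Z = M), ENNReal.ofReal (M * Z).trace

theorem traceInv_eq_of_isUnit_det {n : ℕ} (M A : Matrix (Fin n) (Fin n) ℝ) (hA : IsUnit A.det) :
    traceInv M A = ENNReal.ofReal (M * A⁻¹ * M).trace := by
  unfold traceInv
  apply le_antisymm
  · refine iInf₂_le_of_le (A⁻¹ * M) (Matrix.mul_nonsing_inv_cancel_left A M hA) ?_
    rw [Matrix.mul_assoc]
  · refine le_iInf₂ fun Z hZ => ?_
    have h : A⁻¹ * M = Z := by rw [← hZ, Matrix.nonsing_inv_mul_cancel_left A Z hA]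
    rw [Matrix.mul_assoc, h]

/-- Independence of the solution, for symmetric matrices. -/
theorem traceInv_eq_of_mul_eq {n : ℕ} (M A Z : Matrix (Fin n) (Fin n) ℝ) (hM : Mᵀ = M)
    (hA : Aᵀ = A) (hZ : A * Z = M) : traceInv M A = ENNReal.ofReal (M * Z).trace := by
  unfold traceInv
  have hZ' : Zᵀ * A = M := by rw [← hM, ← hZ, Matrix.transpose_mul, hA]
  have key : ∀ W, A * W = M → (M * W).trace = (M * Z).trace := fun W hW => by
    have h1 : M * W = Zᵀ * M := by rw [← hW, ← Matrix.mul_assoc, hZ', hW]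
    have h2 : M * Z = Zᵀ * M := by
      calc M * Z = Zᵀ * A * Z := by rw [hZ']
        _ = Zᵀ * M := by rw [Matrix.mul_assoc, hZ]
    rw [h1, h2]
  apply le_antisymm
  · exact iInf₂_le Z hZ
  · exact le_iInf₂ fun W hW => by rw [key W hW]

end

/-!
The inequality is a sum of Brascamp–Lieb inequalities. For real `t` the functions `∂ᵢu - t ∂ᵢV` are
odd, hence of mean zero on the symmetric body `K`, and the Brascamp–Lieb inequality
`Var f ≤ avg ⟨(∇²V)⁻¹ ∇f, ∇f⟩` for the log-concave measure `e^{-V} dx` on `K`, applied to each of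
them and summed over `i`, reads
`avg |∇u|² + 2 t avg Lu - t² avg LV ≤ avg tr (∇²u (∇²V)⁻¹ ∇²u)`. The case `u = 0` gives
`avg LV ≥ 0`, and the best choice `t = avg Lu / avg LV` gives the claim.

Since `V` is only twice differentiable, `∂ᵢV` need not be locally Lipschitz and `∇²V` may be
singular, so the Brascamp–Lieb inequality is derived from the midpoint Prékopa–Leindler inequality
(`prekopaLeindler_euclideanSpace`) by a second-order expansion, as follows.

* `integral_sq_sub_fderiv_le` treats a uniformly convex even `W`, a Lipschitz odd `f` and
  a direction `e`. Prékopa–Leindler is applied to `exp (-W (x ± δ e) ± δ f x)`, so that `∂_e W`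
  enters through a translation. Reflection exchanges the two functions, so their integrals agree.
  The sup-convolution is at most `e^{-W} (1 + O(δ²))` uniformly, by uniform convexity, and the upper
  bound for its second-order coefficient at a point only needs the second derivative of `W` and the
  first derivative of `f` there. Fatou's lemma then passes to the limit. The second differences of `W` are controlled in
  mean (`eventually_integral_secondDifference_le`) because a nonnegative pure second derivative is
  locally integrable.
* With `W = V + ε |x|² / 2` the form `(∇²V + ε)⁻¹` appears; it is encoded as a supremum in
  `regularizedDualForm`, which is measurable and whose sum over `f = ∂ᵢu` lies below `traceInv`
  (`ofReal_sum_regularizedDualForm_le_traceInv`). Hence no measurability of `traceInv` is needed.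
* The inequality is first obtained on the dilates `r K`, `r < 1`, where `∂ᵢu` is Lipschitz; then
  `r → 1` and `ε → 0` by dominated convergence (`tendsto_integral_regularized`).
-/

open Filter Topology

/-! ### The Prékopa–Leindler inequality -/

theorem volume_add_volume_le_of_isCompact {A B S : Set ℝ} (hA : IsCompact A) (hB : IsCompact B)
    (hA' : A.Nonempty) (hB' : B.Nonempty) (hS : ∀ a ∈ A, ∀ b ∈ B, a + b ∈ S) :
    volume A + volume B ≤ volume S := by
  obtain ⟨a, ha, hamax⟩ := hA.exists_isGreatest hA'
  obtain ⟨b, hb, hbmin⟩ := hB.exists_isLeast hB'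
  have hdisj : AEDisjoint volume ((fun x => x + b) '' A) ((fun x => a + x) '' B) := by
    refine measure_mono_null (t := {a + b}) ?_ (by simp)
    rintro _ ⟨⟨x, hx, rfl⟩, ⟨y, hy, hxy⟩⟩
    have h1 := hamax hx
    have h2 := hbmin hy
    simp only [mem_singleton_iff]
    simp only at hxy
    linarith
  calc volume A + volume B = volume ((fun x => x + b) '' A) + volume ((fun x => a + x) '' B) := by
        simp
    _ = volume ((fun x => x + b) '' A ∪ (fun x => a + x) '' B) :=
        (measure_union₀ (hB.image (by fun_prop)).measurableSet.nullMeasurableSet hdisj).symm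
    _ ≤ volume S := by
        refine measure_mono (union_subset ?_ ?_)
        · rintro _ ⟨x, hx, rfl⟩
          exact hS x hx b hb
        · rintro _ ⟨y, hy, rfl⟩
          exact hS a ha y hy

/-- The Brunn–Minkowski inequality on the line. -/
theorem volume_add_volume_le {A B S : Set ℝ} (hA : MeasurableSet A) (hB : MeasurableSet B)
    (hA' : A.Nonempty) (hB' : B.Nonempty) (hS : ∀ a ∈ A, ∀ b ∈ B, a + b ∈ S) :
    volume A + volume B ≤ volume S := by
  obtain ⟨a, ha⟩ := hA'
  obtain ⟨b, hb⟩ := hB'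
  rw [hA.measure_eq_iSup_isCompact, hB.measure_eq_iSup_isCompact]
  simp_rw [iSup_and']
  -- The suprema run over compact subsets; adjoining a point makes these nonempty.
  have key : ∀ A₁, A₁ ⊆ A → IsCompact A₁ → ∀ B₁, B₁ ⊆ B → IsCompact B₁ →
      volume A₁ + volume B₁ ≤ volume S := by
    intro A₁ hA₁ hA₁c B₁ hB₁ hB₁c
    refine (add_le_add (measure_mono (subset_insert a A₁))
      (measure_mono (subset_insert b B₁))).trans
      (volume_add_volume_le_of_isCompact (hA₁c.insert a) (hB₁c.insert b) (insert_nonempty _ _)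
      (insert_nonempty _ _) fun x hx y hy =>
        hS x (insert_subset ha hA₁ hx) y (insert_subset hb hB₁ hy))
  exact ENNReal.biSup_add_biSup_le' (p := fun A₁ => A₁ ⊆ A ∧ IsCompact A₁)
    (q := fun B₁ => B₁ ⊆ B ∧ IsCompact B₁) ⟨∅, by simp⟩ ⟨∅, by simp⟩
    fun A₁ h₁ B₁ h₂ => key A₁ h₁.1 h₁.2 B₁ h₂.1 h₂.2

/-- The Prékopa–Leindler inequality on the line, for functions with supremum `1`. -/
theorem lintegral_add_lintegral_le_of_iSup_eq_one {f g h : ℝ → ℝ} (hf : Measurable f)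
    (hg : Measurable g) (hh : Measurable h) (hf0 : ∀ x, 0 ≤ f x) (hg0 : ∀ x, 0 ≤ g x)
    (hh0 : ∀ x, 0 ≤ h x)
    (hf1 : ∀ x, f x ≤ 1) (hg1 : ∀ x, g x ≤ 1) (hf1' : ∀ t, 0 < t → t < 1 → ∃ x, t < f x)
    (hg1' : ∀ t, 0 < t → t < 1 → ∃ x, t < g x)
    (H : ∀ t, 0 < t → ∀ x y, t < f x → t < g y → t < h ((2⁻¹ : ℝ) • (x + y))) :
    (∫⁻ x, ENNReal.ofReal (f x)) + ∫⁻ x, ENNReal.ofReal (g x) ≤ 2 * ∫⁻ x, ENNReal.ofReal (h x) := by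
  rw [lintegral_eq_lintegral_meas_lt volume (.of_forall hf0) hf.aemeasurable,
    lintegral_eq_lintegral_meas_lt volume (.of_forall hg0) hg.aemeasurable,
    lintegral_eq_lintegral_meas_lt volume (.of_forall hh0) hh.aemeasurable,
    ← lintegral_const_mul' _ _ (by simp)]
  have anti : ∀ k : ℝ → ℝ, Measurable fun t => volume {a | t < k a} := fun k =>
    Antitone.measurable fun s t hst => measure_mono fun a ha => lt_of_le_of_lt hst ha
  rw [← lintegral_add_left (anti f)]
  refine setLIntegral_mono' measurableSet_Ioi fun t ht => ?_
  rcases lt_or_ge t 1 with ht1 | ht1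
  · have := volume_add_volume_le (S := (fun x => (2⁻¹ : ℝ) * x) ⁻¹' {a | t < h a})
      (hf measurableSet_Ioi) (hg measurableSet_Ioi) (hf1' t ht ht1)
      (hg1' t ht ht1) (fun a ha b hb => H t ht a b ha hb)
    rwa [Real.volume_preimage_mul_left (by norm_num), inv_inv, abs_of_pos (by norm_num),
      ENNReal.ofReal_ofNat] at this
  · have e1 : {a | t < f a} = ∅ := eq_empty_of_forall_notMem fun a ha =>
      absurd (hf1 a) (not_le.2 (lt_of_le_of_lt ht1 ha))
    have e2 : {a | t < g a} = ∅ := eq_empty_of_forall_notMem fun a ha =>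
      absurd (hg1 a) (not_le.2 (lt_of_le_of_lt ht1 ha))
    simp [e1, e2]

theorem ENNReal.mul_le_sq_of_add_le_two_mul {a b c : ℝ≥0∞} (h : a + b ≤ 2 * c) : a * b ≤ c ^ 2 := by
  rcases eq_or_ne c ∞ with rfl | hc
  · simp
  have h2 : a + b ≠ ∞ := ne_top_of_le_ne_top (ENNReal.mul_ne_top (by simp) hc) h
  lift c to NNReal using hc
  lift a to NNReal using (ENNReal.add_ne_top.1 h2).1
  lift b to NNReal using (ENNReal.add_ne_top.1 h2).2
  norm_cast at h ⊢
  rw [← NNReal.coe_le_coe] at h ⊢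
  push_cast at h ⊢
  nlinarith [sq_nonneg ((a : ℝ) - b), a.2, b.2, c.2]

/-- The midpoint Prékopa–Leindler property of a measure. The exponents `1/2` are avoided by
squaring. -/
def PrekopaLeindler {α : Type*} [AddCommGroup α] [Module ℝ α] [MeasurableSpace α]
    (μ : Measure α) : Prop :=
  ∀ F G H : α → ℝ≥0∞, Measurable F → Measurable G → Measurable H →
    (∀ x y, F x * G y ≤ H ((2⁻¹ : ℝ) • (x + y)) ^ 2) →
    (∫⁻ x, F x ∂μ) * (∫⁻ x, G x ∂μ) ≤ (∫⁻ x, H x ∂μ) ^ 2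

theorem lintegral_mul_lintegral_le_of_bounded {F G H : ℝ → ℝ≥0∞} (hF : Measurable F)
    (hG : Measurable G) (hH : Measurable H) (hFt : ⨆ x, F x ≠ ∞) (hGt : ⨆ x, G x ≠ ∞)
    (hHt : ∀ x, H x ≠ ∞)
    (hFGH : ∀ x y, F x * G y ≤ H ((2⁻¹ : ℝ) • (x + y)) ^ 2) :
    (∫⁻ x, F x) * (∫⁻ x, G x) ≤ (∫⁻ x, H x) ^ 2 := by
  set a := ⨆ x, F x with ha
  set b := ⨆ x, G x with hb
  rcases eq_or_ne a 0 with ha0 | ha0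
  · have : ∀ x, F x = 0 := fun x => le_antisymm (ha0 ▸ le_iSup F x) zero_le
    simp [this]
  rcases eq_or_ne b 0 with hb0 | hb0
  · have : ∀ x, G x = 0 := fun x => le_antisymm (hb0 ▸ le_iSup G x) zero_le
    simp [this]
  have ha' : 0 < a.toReal := ENNReal.toReal_pos ha0 hFt
  have hb' : 0 < b.toReal := ENNReal.toReal_pos hb0 hGt
  have hFa : ∀ x, F x ≠ ∞ := fun x => ne_top_of_le_ne_top hFt (le_iSup F x)
  have hGb : ∀ x, G x ≠ ∞ := fun x => ne_top_of_le_ne_top hGt (le_iSup G x)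
  set c : ℝ := √(a.toReal * b.toReal) with hc
  have hc' : 0 < c := Real.sqrt_pos.2 (by positivity)
  have hc2 : c ^ 2 = a.toReal * b.toReal := Real.sq_sqrt (by positivity)
  have key := lintegral_add_lintegral_le_of_iSup_eq_one
    (f := fun x => a.toReal⁻¹ * (F x).toReal) (g := fun x => b.toReal⁻¹ * (G x).toReal)
    (h := fun x => c⁻¹ * (H x).toReal) (by fun_prop) (by fun_prop) (by fun_prop)
    (fun x => by positivity) (fun x => by positivity) (fun x => by positivity)
    (fun x => by
      rw [inv_mul_le_iff₀ ha', mul_one]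
      exact ENNReal.toReal_mono hFt (le_iSup F x))
    (fun x => by
      rw [inv_mul_le_iff₀ hb', mul_one]
      exact ENNReal.toReal_mono hGt (le_iSup G x))
    (fun t ht0 ht => by
      have : ENNReal.ofReal (a.toReal * t) < a := by
        rw [ENNReal.ofReal_lt_iff_lt_toReal (by positivity) hFt]; nlinarith
      obtain ⟨x, hx⟩ := lt_iSup_iff.1 this
      refine ⟨x, ?_⟩
      rw [lt_inv_mul_iff₀ ha']
      exact (ENNReal.ofReal_lt_iff_lt_toReal (by positivity) (hFa x)).1 hx)
    (fun t ht0 ht => by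
      have : ENNReal.ofReal (b.toReal * t) < b := by
        rw [ENNReal.ofReal_lt_iff_lt_toReal (by positivity) hGt]; nlinarith
      obtain ⟨x, hx⟩ := lt_iSup_iff.1 this
      refine ⟨x, ?_⟩
      rw [lt_inv_mul_iff₀ hb']
      exact (ENNReal.ofReal_lt_iff_lt_toReal (by positivity) (hGb x)).1 hx)
    (fun t ht x y hx hy => by
      rw [lt_inv_mul_iff₀ ha'] at hx
      rw [lt_inv_mul_iff₀ hb'] at hy
      rw [lt_inv_mul_iff₀ hc']
      have := ENNReal.toReal_mono (ENNReal.pow_ne_top (hHt _)) (hFGH x y)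
      rw [ENNReal.toReal_mul, ENNReal.toReal_pow] at this
      refine lt_of_pow_lt_pow_left₀ 2 ENNReal.toReal_nonneg (lt_of_lt_of_le ?_ this)
      calc (c * t) ^ 2 = (a.toReal * t) * (b.toReal * t) := by rw [mul_pow, hc2]; ring
        _ < _ := mul_lt_mul'' hx hy (by positivity) (by positivity))
  have conv : ∀ (r : ℝ) (P : ℝ → ℝ≥0∞), 0 < r → (∀ x, P x ≠ ∞) →
      ∫⁻ x, P x = ENNReal.ofReal r * ∫⁻ x, ENNReal.ofReal (r⁻¹ * (P x).toReal) := by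
    intro r P hr hP
    rw [← lintegral_const_mul' _ _ (by simp)]
    refine lintegral_congr fun x => ?_
    rw [← ENNReal.ofReal_mul hr.le, ← mul_assoc, mul_inv_cancel₀ hr.ne', one_mul,
      ENNReal.ofReal_toReal (hP x)]
  rw [conv _ F ha' hFa, conv _ G hb' hGb, conv _ H hc' hHt, mul_mul_mul_comm, mul_pow,
    ← ENNReal.ofReal_pow hc'.le, hc2, ENNReal.ofReal_mul ha'.le]
  gcongr
  exact ENNReal.mul_le_sq_of_add_le_two_mul key

theorem lintegral_eq_iSup_lintegral_min {α : Type*} [MeasurableSpace α] {μ : Measure α}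
    {F : α → ℝ≥0∞} (hF : Measurable F) :
    ∫⁻ x, F x ∂μ = ⨆ N : ℕ, ∫⁻ x, min (F x) N ∂μ := by
  rw [← lintegral_iSup (fun N => hF.min measurable_const)
    (fun i j hij x => min_le_min le_rfl (by exact_mod_cast hij))]
  refine lintegral_congr fun x => le_antisymm ?_ (iSup_le fun N => min_le_left _ _)
  rcases eq_or_ne (F x) ∞ with h | h
  · simp [h, ENNReal.iSup_natCast]
  · obtain ⟨N, hN⟩ := ENNReal.exists_nat_gt h
    exact le_iSup_of_le N (by rw [min_eq_left hN.le])

theorem prekopaLeindler_real : PrekopaLeindler (volume : Measure ℝ) := by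
  intro F G H hF hG hH h
  rw [lintegral_eq_iSup_lintegral_min hF, lintegral_eq_iSup_lintegral_min hG, ENNReal.iSup_mul]
  refine iSup_le fun N => ?_
  rw [ENNReal.mul_iSup]
  refine iSup_le fun M => ?_
  set P : ℝ≥0∞ := max N M
  have hP : P ≠ ∞ := by simp [P]
  refine (lintegral_mul_lintegral_le_of_bounded (H := fun x => min (H x) P)
    (hF.min measurable_const) (hG.min measurable_const)
    (hH.min measurable_const)
    (ne_top_of_le_ne_top (ENNReal.natCast_ne_top N) (iSup_le fun x => min_le_right _ _))
    (ne_top_of_le_ne_top (ENNReal.natCast_ne_top M) (iSup_le fun x => min_le_right _ _))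
    (fun x => ne_top_of_le_ne_top hP (min_le_right _ _)) fun x y => ?_).trans ?_
  · rcases min_choice (H ((2⁻¹ : ℝ) • (x + y))) P with h1 | h1 <;> rw [h1]
    · exact (mul_le_mul' (min_le_left _ _) (min_le_left _ _)).trans (h x y)
    · rw [sq]
      exact mul_le_mul' ((min_le_right _ _).trans (le_max_left _ _))
        ((min_le_right _ _).trans (le_max_right _ _))
  · gcongr
    exact min_le_left _ _

theorem PrekopaLeindler.prod {α β : Type*} [AddCommGroup α] [Module ℝ α] [MeasurableSpace α]
    [AddCommGroup β] [Module ℝ β] [MeasurableSpace β] {μ : Measure α} {ν : Measure β}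
    [SFinite μ] [SFinite ν] (hμ : PrekopaLeindler μ) (hν : PrekopaLeindler ν) :
    PrekopaLeindler (μ.prod ν) := by
  intro F G H hF hG hH h
  rw [lintegral_prod _ hF.aemeasurable, lintegral_prod _ hG.aemeasurable,
    lintegral_prod _ hH.aemeasurable]
  refine hμ _ _ _ hF.lintegral_prod_right' hG.lintegral_prod_right' hH.lintegral_prod_right' ?_
  intro x y
  exact hν _ _ _ (hF.comp measurable_prodMk_left) (hG.comp measurable_prodMk_left)
    (hH.comp measurable_prodMk_left) fun x' y' => h (x, x') (y, y')

theorem PrekopaLeindler.of_measurePreserving {α β : Type*} [AddCommGroup α] [Module ℝ α]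
    [MeasurableSpace α] [AddCommGroup β] [Module ℝ β] [MeasurableSpace β] {μ : Measure α}
    {ν : Measure β} (hμ : PrekopaLeindler μ) (φ : α → β) (hφ : MeasurePreserving φ μ ν)
    (hadd : ∀ x y, φ ((2⁻¹ : ℝ) • (x + y)) = (2⁻¹ : ℝ) • (φ x + φ y)) : PrekopaLeindler ν := by
  intro F G H hF hG hH h
  rw [← hφ.lintegral_comp hF, ← hφ.lintegral_comp hG, ← hφ.lintegral_comp hH]
  refine hμ _ _ _ (hF.comp hφ.measurable) (hG.comp hφ.measurable) (hH.comp hφ.measurable) ?_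
  intro x y
  simpa only [hadd] using h (φ x) (φ y)

theorem prekopaLeindler_pi (n : ℕ) : PrekopaLeindler (volume : Measure (Fin n → ℝ)) := by
  induction n with
  | zero =>
    intro F G H hF hG hH h
    have e : (volume : Measure (Fin 0 → ℝ)) = Measure.dirac 0 := by
      rw [volume_pi, Measure.pi_of_empty (x := 0)]
    rw [e, lintegral_dirac, lintegral_dirac, lintegral_dirac]
    have := h 0 0
    rwa [add_zero, smul_zero] at this
  | succ n ih =>
    refine (prekopaLeindler_real.prod ih).of_measurePreserving _
      (volume_preserving_piFinSuccAbove (fun _ => ℝ) 0).symm fun x y => ?_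
    ext i
    refine Fin.cases ?_ (fun j => ?_) i <;>
      simp [MeasurableEquiv.piFinSuccAbove, mul_add]

theorem prekopaLeindler_euclideanSpace (n : ℕ) : PrekopaLeindler (volume : Measure (Rn n)) :=
  (prekopaLeindler_pi n).of_measurePreserving _
    (EuclideanSpace.volume_preserving_symm_measurableEquiv_toLp (Fin n)).symm fun x y => by
      ext i; simp

/-! ### Second differences of twice differentiable functions -/

section SecondDifference

variable {E : Type*} [NormedAddCommGroup E] [NormedSpace ℝ E]

theorem hasDerivAt_comp_add_smul {F : Type*} [NormedAddCommGroup F] [NormedSpace ℝ F] {g : E → F}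
    (hg : Differentiable ℝ g) (x e : E) (s : ℝ) :
    HasDerivAt (fun s : ℝ => g (x + s • e)) (fderiv ℝ g (x + s • e) e) s := by
  have h1 : HasDerivAt (fun s : ℝ => x + s • e) e s := by
    simpa using ((hasDerivAt_id s).smul_const e).const_add x
  exact (hg _).hasFDerivAt.comp_hasDerivAt s h1

theorem hasDerivAt_comp_sub_smul {F : Type*} [NormedAddCommGroup F] [NormedSpace ℝ F] {g : E → F}
    (hg : Differentiable ℝ g) (x e : E) (s : ℝ) :
    HasDerivAt (fun s : ℝ => g (x - s • e)) (-fderiv ℝ g (x - s • e) e) s := by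
  simpa [sub_eq_add_neg] using hasDerivAt_comp_add_smul hg x (-e) s

/-- Peano's form of the second-order expansion; the second derivative need only exist at `z`. -/
theorem eventually_abs_secondDifference_le {W : E → ℝ} (hW : Differentiable ℝ W) {z : E}
    (hW2 : DifferentiableAt ℝ (fderiv ℝ W) z) {η : ℝ} (hη : 0 < η) :
    ∀ᶠ k in 𝓝 (0 : E),
      |W (z + k) + W (z - k) - 2 * W z - fderiv ℝ (fderiv ℝ W) z k k| ≤ η * ‖k‖ ^ 2 := by
  have h := hasFDerivAt_iff_isLittleO_nhds_zero.1 hW2.hasFDerivAt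
  obtain ⟨r, hr, hball⟩ := Metric.eventually_nhds_iff.1 (h.def (half_pos hη))
  refine Metric.eventually_nhds_iff.2 ⟨r, hr, fun k hk => ?_⟩
  set A := fderiv ℝ (fderiv ℝ W) z
  have hderiv : ∀ s : ℝ, HasDerivAt (fun s : ℝ => W (z + s • k) + W (z - s • k) - s ^ 2 * A k k)
      (fderiv ℝ W (z + s • k) k + -fderiv ℝ W (z - s • k) k - 2 * s * A k k) s := fun s => by
    refine (((hasDerivAt_comp_add_smul hW z k s).add (hasDerivAt_comp_sub_smul hW z k s)).sub
      ((hasDerivAt_pow 2 s).mul_const (A k k))).congr_deriv ?_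
    simp
  have := norm_image_sub_le_of_norm_deriv_le_segment_01' (C := η * ‖k‖ ^ 2)
    (fun s _ => (hderiv s).hasDerivWithinAt) (fun s hs => ?_)
  · rw [Real.norm_eq_abs] at this
    convert this using 2
    simp; ring
  · have hs1 : ‖s • k‖ ≤ ‖k‖ := by
      rw [norm_smul, Real.norm_of_nonneg hs.1]
      exact mul_le_of_le_one_left (norm_nonneg _) hs.2.le
    have hsk : dist (s • k) 0 < r := by
      rw [dist_zero_right] at hk ⊢
      exact hs1.trans_lt hk
    have h1 := hball hsk
    have h2 := hball (y := -(s • k)) (by simpa using hsk)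
    rw [norm_neg] at h2
    have e : fderiv ℝ W (z + s • k) k + -fderiv ℝ W (z - s • k) k - 2 * s * A k k =
        ((fderiv ℝ W (z + s • k) - fderiv ℝ W z - A (s • k)) -
          (fderiv ℝ W (z + -(s • k)) - fderiv ℝ W z - A (-(s • k)))) k := by
      simp [← sub_eq_add_neg]; ring
    rw [e]
    refine (ContinuousLinearMap.le_opNorm _ _).trans ?_
    calc _ ≤ (η / 2 * ‖s • k‖ + η / 2 * ‖s • k‖) * ‖k‖ := by
          gcongr
          exact (norm_sub_le _ _).trans (add_le_add h1 h2)
      _ = η * ‖s • k‖ * ‖k‖ := by ring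
      _ ≤ η * ‖k‖ * ‖k‖ := by gcongr
      _ = η * ‖k‖ ^ 2 := by ring

theorem tendsto_secondDifference_div {W : E → ℝ} (hW : Differentiable ℝ W) {z : E}
    (hW2 : DifferentiableAt ℝ (fderiv ℝ W) z) (e : E) :
    Tendsto (fun δ : ℝ => (W (z + δ • e) + W (z - δ • e) - 2 * W z) / δ ^ 2) (𝓝[>] 0)
      (𝓝 (fderiv ℝ (fderiv ℝ W) z e e)) := by
  rw [Metric.tendsto_nhds]
  intro η hη
  set c := η / (‖e‖ ^ 2 + 1) with hc
  have hc' : 0 < c := by positivity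
  have h0 : Tendsto (fun δ : ℝ => δ • e) (𝓝[>] 0) (𝓝 0) := by
    have : Tendsto (fun δ : ℝ => δ • e) (𝓝 0) (𝓝 ((0 : ℝ) • e)) := by
      apply Continuous.tendsto; fun_prop
    rw [zero_smul] at this
    exact this.mono_left nhdsWithin_le_nhds
  filter_upwards [h0.eventually (eventually_abs_secondDifference_le hW hW2 hc'),
    self_mem_nhdsWithin] with δ hδ hδ0
  have hδ0 : 0 < δ := hδ0
  have e1 : (W (z + δ • e) + W (z - δ • e) - 2 * W z) / δ ^ 2 - fderiv ℝ (fderiv ℝ W) z e e =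
      (W (z + δ • e) + W (z - δ • e) - 2 * W z -
        fderiv ℝ (fderiv ℝ W) z (δ • e) (δ • e)) / δ ^ 2 := by
    simp only [map_smul, smul_apply, smul_eq_mul]
    field_simp
  rw [Real.dist_eq, e1, abs_div, abs_of_pos (by positivity : 0 < δ ^ 2),
    div_lt_iff₀ (by positivity)]
  refine hδ.trans_lt ?_
  rw [norm_smul, Real.norm_of_nonneg hδ0.le, mul_pow]
  have : c * (‖e‖ ^ 2 + 1) = η := by rw [hc]; field_simp
  nlinarith [sq_pos_of_pos hδ0]

theorem fderiv_fderiv_nonneg {W : E → ℝ} (hW : Differentiable ℝ W)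
    (hW2 : Differentiable ℝ (fderiv ℝ W))
    (hD : ∀ x h, 0 ≤ W (x + h) + W (x - h) - 2 * W x) (x e : E) :
    0 ≤ fderiv ℝ (fderiv ℝ W) x e e :=
  ge_of_tendsto (tendsto_secondDifference_div hW (hW2 x) e)
    (Eventually.of_forall fun δ => div_nonneg (hD x _) (sq_nonneg δ))

/-- The fundamental theorem of calculus for a nonnegative derivative, which is automatically
integrable. -/
theorem lintegral_deriv_of_nonneg {g g' : ℝ → ℝ} {a b : ℝ} (hab : a ≤ b)
    (hg : ∀ s, HasDerivAt g (g' s) s) (hg' : ∀ s ∈ Ioo a b, 0 ≤ g' s) :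
    ∫⁻ s in Ioc a b, ENNReal.ofReal (g' s) = ENNReal.ofReal (g b - g a) := by
  have hint : IntervalIntegrable g' volume a b :=
    intervalIntegral.intervalIntegrable_deriv_of_nonneg
      (fun s _ => (hg s).continuousAt.continuousWithinAt) (fun s _ => hg s)
      (by rwa [min_eq_left hab, max_eq_right hab])
  rw [← intervalIntegral.integral_eq_sub_of_hasDerivAt (fun s _ => hg s) hint,
    intervalIntegral.integral_of_le hab,
    ofReal_integral_eq_lintegral_ofReal
      ((intervalIntegrable_iff_integrableOn_Ioc_of_le hab).1 hint)]
  rw [← Measure.restrict_congr_set Ioo_ae_eq_Ioc]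
  exact (ae_restrict_iff' measurableSet_Ioo).2 (.of_forall fun s hs => hg' s hs)

theorem lintegral_fderiv_fderiv_line {W : E → ℝ}
    (hW2 : Differentiable ℝ (fderiv ℝ W)) {e : E}
    (hnn : ∀ x, 0 ≤ fderiv ℝ (fderiv ℝ W) x e e) (x : E) :
    ∫⁻ s in Ioc (0 : ℝ) 1, ENNReal.ofReal (fderiv ℝ (fderiv ℝ W) (x + s • e) e e) =
      ENNReal.ofReal (fderiv ℝ W (x + e) e - fderiv ℝ W x e) := by
  have := lintegral_deriv_of_nonneg zero_le_one
    (fun s => (hasDerivAt_comp_add_smul hW2 x e s).clm_apply (hasDerivAt_const s e))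
    (fun s _ => by simpa using hnn (x + s • e))
  simpa using this

/-- The second difference is the average of the second derivative along the segment against a
triangular kernel. -/
theorem ofReal_secondDifference {W : E → ℝ} (hW : Differentiable ℝ W)
    (hW2 : Differentiable ℝ (fderiv ℝ W)) {e : E}
    (hnn : ∀ x, 0 ≤ fderiv ℝ (fderiv ℝ W) x e e) (x : E) {δ : ℝ} (hδ : 0 ≤ δ) :
    ENNReal.ofReal (W (x + δ • e) + W (x - δ • e) - 2 * W x) =
      ∫⁻ s in Ioc 0 δ, ENNReal.ofReal ((δ - s) *
        (fderiv ℝ (fderiv ℝ W) (x + s • e) e e + fderiv ℝ (fderiv ℝ W) (x - s • e) e e)) := by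
  have hd : ∀ s : ℝ, HasDerivAt (fun s : ℝ => (δ - s) * (fderiv ℝ W (x + s • e) e -
      fderiv ℝ W (x - s • e) e) + (W (x + s • e) + W (x - s • e)))
      ((δ - s) * (fderiv ℝ (fderiv ℝ W) (x + s • e) e e +
        fderiv ℝ (fderiv ℝ W) (x - s • e) e e)) s := fun s => by
    have h1 := ((hasDerivAt_comp_add_smul hW2 x e s).clm_apply (hasDerivAt_const s e)).sub
      ((hasDerivAt_comp_sub_smul hW2 x e s).clm_apply (hasDerivAt_const s e))
    have h2 := (hasDerivAt_comp_add_smul hW x e s).add (hasDerivAt_comp_sub_smul hW x e s)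
    have h3 := (((hasDerivAt_id s).const_sub δ).mul h1).add h2
    refine h3.congr_deriv ?_
    simp
    ring
  rw [lintegral_deriv_of_nonneg hδ hd fun s hs =>
    mul_nonneg (sub_nonneg.2 hs.2.le) (add_nonneg (hnn _) (hnn _))]
  congr 1
  simp; ring

end SecondDifference

section Integrability

variable {n : ℕ}

theorem measurable_fderiv_fderiv_apply (W : Rn n → ℝ) (e e' : Rn n) :
    Measurable fun x => fderiv ℝ (fderiv ℝ W) x e e' := by
  have h : Measurable fun x => fderiv ℝ (fderiv ℝ W) x e := measurable_fderiv_apply_const ℝ _ e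
  exact (ContinuousLinearMap.apply ℝ ℝ e').measurable.comp h

/-- A nonnegative pure second derivative is locally integrable: its integral along segments is
bounded by the oscillation of the first derivative. -/
theorem lintegral_ball_fderiv_fderiv_lt_top {W : Rn n → ℝ}
    (hW2 : Differentiable ℝ (fderiv ℝ W)) {e : Rn n}
    (hnn : ∀ x, 0 ≤ fderiv ℝ (fderiv ℝ W) x e e) (R : ℝ) :
    ∫⁻ x in Metric.ball 0 R, ENNReal.ofReal (fderiv ℝ (fderiv ℝ W) x e e) < ∞ := by
  set φ : Rn n → ℝ≥0∞ := fun x => ENNReal.ofReal (fderiv ℝ (fderiv ℝ W) x e e) with hφdef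
  have hφ : Measurable φ := (measurable_fderiv_fderiv_apply W e e).ennreal_ofReal
  set B := Metric.ball (0 : Rn n) (R + ‖e‖) with hB
  have h1 : ∀ s ∈ Ioc (0 : ℝ) 1, ∫⁻ x in Metric.ball 0 R, φ x ≤ ∫⁻ x in B, φ (x + s • e) := by
    intro s hs
    rw [← lintegral_indicator Metric.isOpen_ball.measurableSet,
      ← lintegral_indicator Metric.isOpen_ball.measurableSet,
      ← lintegral_add_right_eq_self _ (s • e)]
    refine lintegral_mono fun x => ?_
    by_cases hx : x + s • e ∈ Metric.ball (0 : Rn n) R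
    · have hxB : x ∈ B := by
        rw [mem_ball_zero_iff] at hx ⊢
        have h2 : ‖s • e‖ ≤ ‖e‖ := by
          rw [norm_smul, Real.norm_of_nonneg hs.1.le]
          exact mul_le_of_le_one_left (norm_nonneg _) hs.2
        have h3 := norm_sub_le (x + s • e) (s • e)
        rw [add_sub_cancel_right] at h3
        linarith
      rw [indicator_of_mem hx, indicator_of_mem hxB]
    · rw [indicator_of_notMem hx]
      exact zero_le
  have hcont : Continuous fun x => fderiv ℝ W (x + e) e - fderiv ℝ W x e := by
    have := hW2.continuous
    fun_prop
  obtain ⟨C, hC⟩ := (isCompact_closedBall (0 : Rn n) (R + ‖e‖)).bddAbove_image hcont.continuousOn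
  calc ∫⁻ x in Metric.ball 0 R, φ x
      = ∫⁻ _ in Ioc (0 : ℝ) 1, ∫⁻ x in Metric.ball 0 R, φ x := by simp
    _ ≤ ∫⁻ s in Ioc (0 : ℝ) 1, ∫⁻ x in B, φ (x + s • e) :=
        setLIntegral_mono' measurableSet_Ioc h1
    _ = ∫⁻ x in B, ∫⁻ s in Ioc (0 : ℝ) 1, φ (x + s • e) := by
        refine lintegral_lintegral_swap (hφ.comp ?_).aemeasurable
        fun_prop
    _ ≤ ∫⁻ x in B, ENNReal.ofReal C := by
        refine setLIntegral_mono' Metric.isOpen_ball.measurableSet fun x hx => ?_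
        rw [lintegral_fderiv_fderiv_line hW2 hnn]
        exact ENNReal.ofReal_le_ofReal (hC ⟨x, Metric.ball_subset_closedBall hx, rfl⟩)
    _ < ∞ := by
        rw [setLIntegral_const]
        exact ENNReal.mul_lt_top (by simp) Metric.isBounded_ball.measure_lt_top

theorem integrableOn_fderiv_fderiv_of_isBounded {W : Rn n → ℝ}
    (hW2 : Differentiable ℝ (fderiv ℝ W)) {e : Rn n}
    (hnn : ∀ x, 0 ≤ fderiv ℝ (fderiv ℝ W) x e e) {S : Set (Rn n)} (hS : Bornology.IsBounded S) :
    IntegrableOn (fun x => fderiv ℝ (fderiv ℝ W) x e e) S := by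
  obtain ⟨R, hR⟩ := hS.subset_ball 0
  refine IntegrableOn.mono_set ?_ hR
  refine ⟨(measurable_fderiv_fderiv_apply W e e).aestronglyMeasurable, ?_⟩
  rw [hasFiniteIntegral_iff_ofReal (.of_forall hnn)]
  exact lintegral_ball_fderiv_fderiv_lt_top hW2 hnn R

/-- Continuity of translation against a continuous weight on a bounded domain with null
boundary. -/
theorem tendsto_lintegral_comp_add_smul {φ : Rn n → ℝ≥0∞} (hφ : Measurable φ)
    (hφint : ∀ R, ∫⁻ x in Metric.ball 0 R, φ x < ∞) {Ω : Set (Rn n)} (hΩ : MeasurableSet Ω)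
    (hΩb : Bornology.IsBounded Ω) (hΩf : volume (frontier Ω) = 0) {w : Rn n → ℝ}
    (hw : Continuous w) (e : Rn n) :
    Tendsto (fun s : ℝ => ∫⁻ x in Ω, ENNReal.ofReal (w x) * φ (x + s • e)) (𝓝 0)
      (𝓝 (∫⁻ x in Ω, ENNReal.ofReal (w x) * φ x)) := by
  set ψ : ℝ → Rn n → ℝ≥0∞ := fun s y =>
    Ω.indicator (fun x => ENNReal.ofReal (w x)) (y - s • e) * φ y with hψ
  have hind : Measurable (Ω.indicator fun x => ENNReal.ofReal (w x)) :=
    (hw.measurable.ennreal_ofReal).indicator hΩ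
  -- Shift the translation from `φ`, which is merely integrable, to the weight.
  have e1 : ∀ s : ℝ, ∫⁻ x in Ω, ENNReal.ofReal (w x) * φ (x + s • e) = ∫⁻ y, ψ s y := by
    intro s
    rw [← lintegral_indicator hΩ, ← lintegral_add_right_eq_self (ψ s) (s • e)]
    refine lintegral_congr fun x => ?_
    simp only [hψ, add_sub_cancel_right]
    by_cases hx : x ∈ Ω <;> simp [hx]
  have e2 : ∫⁻ x in Ω, ENNReal.ofReal (w x) * φ x = ∫⁻ y, ψ 0 y := by
    rw [← e1 0]; simp
  simp_rw [e1, e2]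
  obtain ⟨R, hR⟩ := hΩb.subset_ball 0
  obtain ⟨C, hC⟩ := (isCompact_closedBall (0 : Rn n) R).bddAbove_image hw.continuousOn
  set B := Metric.ball (0 : Rn n) (R + ‖e‖)
  refine tendsto_lintegral_filter_of_dominated_convergence
    (B.indicator fun y => ENNReal.ofReal C * φ y) ?_ ?_ ?_ ?_
  · exact .of_forall fun s => (hind.comp (by fun_prop)).mul hφ
  · filter_upwards [Metric.ball_mem_nhds (0 : ℝ) one_pos] with s hs
    refine .of_forall fun y => ?_
    by_cases hy : y - s • e ∈ Ω
    · have hyB : y ∈ B := by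
        have h1 := hR hy
        rw [mem_ball_zero_iff] at h1 hs ⊢
        have h2 : ‖s • e‖ ≤ ‖e‖ := by
          rw [norm_smul]
          exact mul_le_of_le_one_left (norm_nonneg _) hs.le
        have h3 := norm_add_le (y - s • e) (s • e)
        rw [sub_add_cancel] at h3
        linarith
      rw [indicator_of_mem hyB]
      simp only [hψ, indicator_of_mem hy]
      gcongr
      exact hC ⟨_, Metric.ball_subset_closedBall (hR hy), rfl⟩
    · simp [hψ, indicator_of_notMem hy]
  · rw [lintegral_indicator Metric.isOpen_ball.measurableSet, lintegral_const_mul _ hφ]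
    exact (ENNReal.mul_lt_top (by simp) (hφint _)).ne
  · have h0 : ∀ᵐ y ∂(volume : Measure (Rn n)), y ∉ frontier Ω :=
      measure_eq_zero_iff_ae_notMem.1 hΩf
    have hfin : ∀ᵐ y ∂(volume : Measure (Rn n)), φ y < ∞ := by
      have : ∀ N : ℕ, ∀ᵐ y ∂(volume : Measure (Rn n)), y ∈ Metric.ball (0 : Rn n) N → φ y < ∞ :=
        fun N => (ae_restrict_iff' Metric.isOpen_ball.measurableSet).1
          (ae_lt_top hφ (hφint N).ne)
      filter_upwards [ae_all_iff.2 this] with y hy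
      obtain ⟨N, hN⟩ := exists_nat_gt ‖y‖
      exact hy N (by simpa using hN)
    filter_upwards [h0, hfin] with y hy hyfin
    have ht : Tendsto (fun s : ℝ => y - s • e) (𝓝 0) (𝓝 (y - (0 : ℝ) • e)) := by
      apply Continuous.tendsto; fun_prop
    refine ENNReal.Tendsto.mul_const ?_ (Or.inr hyfin.ne)
    rw [zero_smul, sub_zero] at ht ⊢
    have hcA : ContinuousAt (Ω.indicator fun x => ENNReal.ofReal (w x)) y := by
      have hc : Continuous fun x => ENNReal.ofReal (w x) := ENNReal.continuous_ofReal.comp hw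
      exact hc.continuousOn.continuousAt_indicator hy
    exact hcA.tendsto.comp ht

theorem lintegral_Ioc_ofReal_sub {δ : ℝ} (hδ : 0 ≤ δ) :
    ∫⁻ s in Ioc 0 δ, ENNReal.ofReal (δ - s) = ENNReal.ofReal (δ ^ 2 / 2) := by
  have := lintegral_deriv_of_nonneg (g := fun s => δ * s - s ^ 2 / 2) (g' := fun s => δ - s) hδ
    (fun s => by
      refine (((hasDerivAt_id s).const_mul δ).sub ((hasDerivAt_pow 2 s).div_const 2)).congr_deriv ?_
      simp) (fun s hs => sub_nonneg.2 hs.2.le)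
  rw [this]
  congr 1
  ring

theorem integrableOn_of_continuous_of_isBounded {g : Rn n → ℝ} (hg : Continuous g)
    {S : Set (Rn n)} (hS : Bornology.IsBounded S) : IntegrableOn g S := by
  obtain ⟨R, hR⟩ := hS.subset_closedBall 0
  exact (hg.continuousOn.integrableOn_compact (isCompact_closedBall _ _)).mono_set hR

theorem MeasureTheory.IntegrableOn.continuous_mul_of_isBounded {g w : Rn n → ℝ} {S : Set (Rn n)}
    (hg : IntegrableOn g S) (hw : Continuous w) (hSm : MeasurableSet S)
    (hS : Bornology.IsBounded S) : IntegrableOn (fun x => w x * g x) S := by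
  obtain ⟨R, hR⟩ := hS.subset_closedBall 0
  obtain ⟨B, hB⟩ := (isCompact_closedBall (0 : Rn n) R).bddAbove_image hw.norm.continuousOn
  refine Integrable.bdd_mul (c := B) hg hw.aestronglyMeasurable ?_
  filter_upwards [ae_restrict_mem hSm] with x hx using hB ⟨x, hR hx, rfl⟩

/-- An upper bound in the mean for second differences. No pointwise domination is available, as
`D²W (e, e)` may be unbounded; Tonelli's theorem reduces it to continuity of translation. -/
theorem eventually_integral_secondDifference_le {W : Rn n → ℝ} (hW : Differentiable ℝ W)
    (hW2 : Differentiable ℝ (fderiv ℝ W)) {e : Rn n}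
    (hD : ∀ x h, 0 ≤ W (x + h) + W (x - h) - 2 * W x) {Ω : Set (Rn n)} (hΩ : MeasurableSet Ω)
    (hΩb : Bornology.IsBounded Ω) (hΩf : volume (frontier Ω) = 0) {w : Rn n → ℝ}
    (hw : Continuous w) (hw0 : ∀ x, 0 ≤ w x) {η : ℝ} (hη : 0 < η) :
    ∀ᶠ δ in 𝓝[>] (0 : ℝ),
      ∫ x in Ω, w x * (W (x + δ • e) + W (x - δ • e) - 2 * W x) ≤
        δ ^ 2 * ((∫ x in Ω, w x * fderiv ℝ (fderiv ℝ W) x e e) + η) := by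
  have hnn := fun x => fderiv_fderiv_nonneg hW hW2 hD x e
  set φ : Rn n → ℝ≥0∞ := fun x => ENNReal.ofReal (fderiv ℝ (fderiv ℝ W) x e e) with hφdef
  have hφ : Measurable φ := (measurable_fderiv_fderiv_apply W e e).ennreal_ofReal
  set G : ℝ → ℝ≥0∞ := fun s => ∫⁻ x in Ω, ENNReal.ofReal (w x) * φ (x + s • e) with hG
  have hGt : Tendsto G (𝓝 0) (𝓝 (∫⁻ x in Ω, ENNReal.ofReal (w x) * φ x)) :=
    tendsto_lintegral_comp_add_smul hφ (lintegral_ball_fderiv_fderiv_lt_top hW2 hnn) hΩ hΩb hΩf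
      hw e
  set I := ∫ x in Ω, w x * fderiv ℝ (fderiv ℝ W) x e e with hI
  have hint : IntegrableOn (fun x => w x * fderiv ℝ (fderiv ℝ W) x e e) Ω :=
    (integrableOn_fderiv_fderiv_of_isBounded hW2 hnn hΩb).continuous_mul_of_isBounded hw hΩ hΩb
  have hI0 : 0 ≤ I := integral_nonneg fun x => mul_nonneg (hw0 x) (hnn x)
  have hGI : ∫⁻ x in Ω, ENNReal.ofReal (w x) * φ x = ENNReal.ofReal I := by
    rw [hI, ofReal_integral_eq_lintegral_ofReal hint
      (.of_forall fun x => mul_nonneg (hw0 x) (hnn x))]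
    exact lintegral_congr fun x => (ENNReal.ofReal_mul (hw0 x)).symm
  rw [hGI] at hGt
  have hlt : ENNReal.ofReal I < ENNReal.ofReal (I + η) :=
    (ENNReal.ofReal_lt_ofReal_iff (by linarith)).2 (by linarith)
  obtain ⟨r, hr, hball⟩ := Metric.eventually_nhds_iff.1 (hGt.eventually (gt_mem_nhds hlt))
  filter_upwards [Ioo_mem_nhdsGT hr] with δ hδ
  have hδ0 := hδ.1
  have hcontD : Continuous fun x => w x * (W (x + δ • e) + W (x - δ • e) - 2 * W x) := by
    have := hW.continuous
    fun_prop
  rw [← ENNReal.ofReal_le_ofReal_iff (by positivity), ofReal_integral_eq_lintegral_ofReal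
    (integrableOn_of_continuous_of_isBounded hcontD hΩb)
    (.of_forall fun x => mul_nonneg (hw0 x) (hD x _))]
  calc ∫⁻ x in Ω, ENNReal.ofReal (w x * (W (x + δ • e) + W (x - δ • e) - 2 * W x))
      = ∫⁻ x in Ω, ∫⁻ s in Ioc 0 δ, ENNReal.ofReal (δ - s) *
          (ENNReal.ofReal (w x) * φ (x + s • e) + ENNReal.ofReal (w x) * φ (x + (-s) • e)) := by
        refine lintegral_congr fun x => ?_
        rw [ENNReal.ofReal_mul (hw0 x), ofReal_secondDifference hW hW2 hnn x hδ0.le,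
          ← lintegral_const_mul' _ _ (by simp)]
        refine setLIntegral_congr_fun measurableSet_Ioc fun s hs => ?_
        simp only [hφdef]
        rw [ENNReal.ofReal_mul (sub_nonneg.2 hs.2), ENNReal.ofReal_add (hnn _) (hnn _), neg_smul,
          ← sub_eq_add_neg]
        ring
    _ = ∫⁻ s in Ioc 0 δ, ENNReal.ofReal (δ - s) * (G s + G (-s)) := by
        rw [lintegral_lintegral_swap]
        · refine lintegral_congr fun s => ?_
          rw [lintegral_const_mul' _ _ (by simp), lintegral_add_left]
          exact hw.measurable.ennreal_ofReal.mul (hφ.comp (by fun_prop))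
        · have h1 : Measurable fun p : Rn n × ℝ => φ (p.1 + p.2 • e) := hφ.comp (by fun_prop)
          have h2 : Measurable fun p : Rn n × ℝ => φ (p.1 + (-p.2) • e) := hφ.comp (by fun_prop)
          have h3 : Measurable w := hw.measurable
          exact Measurable.aemeasurable (by unfold Function.uncurry; fun_prop)
    _ ≤ ∫⁻ s in Ioc 0 δ, ENNReal.ofReal (δ - s) * (2 * ENNReal.ofReal (I + η)) := by
        refine setLIntegral_mono' measurableSet_Ioc fun s hs => ?_
        have hs1 : dist s 0 < r := by
          rw [Real.dist_eq, sub_zero, abs_of_pos hs.1]; exact hs.2.trans_lt hδ.2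
        have hs2 : dist (-s) 0 < r := by
          rw [Real.dist_eq, sub_zero, abs_neg, abs_of_pos hs.1]; exact hs.2.trans_lt hδ.2
        rw [two_mul]
        gcongr
        · exact (hball hs1).le
        · exact (hball hs2).le
    _ = ENNReal.ofReal (δ ^ 2 * (I + η)) := by
        rw [lintegral_mul_const' _ _ (ENNReal.mul_ne_top (by simp) (by simp)),
          lintegral_Ioc_ofReal_sub hδ0.le, ← ENNReal.ofReal_ofNat 2,
          ← ENNReal.ofReal_mul (by norm_num), ← ENNReal.ofReal_mul (by positivity)]
        congr 1
        ring

end Integrability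

/-! ### The Brascamp–Lieb inequality on a convex set -/

section BrascampLieb

variable {n : ℕ}

/-- The Prékopa–Leindler inequality for `e^{-p}` on a symmetric convex open set and its reflection.
The sup-convolution `H` is described through its universal property. -/
theorem exists_supConvolution {Ω : Set (Rn n)} (hΩo : IsOpen Ω) (hΩc : Convex ℝ Ω)
    (hΩneg : ∀ x ∈ Ω, -x ∈ Ω) {p : Rn n → ℝ} (hp : Continuous p) :
    ∃ H : Rn n → ℝ≥0∞, Measurable H ∧
      (∀ z c, (∀ x ∈ Ω, ∀ y ∈ Ω, x + y = (2 : ℝ) • z →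
        ENNReal.ofReal (Real.exp (-(p x + p (-y)) / 2)) ≤ c) → H z ≤ c) ∧
      ∫⁻ x in Ω, ENNReal.ofReal (Real.exp (-p x)) ≤ ∫⁻ z in Ω, H z := by
  set g : Rn n → Rn n → ℝ≥0∞ := fun h z =>
    {z | z + h ∈ Ω ∧ z - h ∈ Ω}.indicator
      (fun z => ENNReal.ofReal (Real.exp (-(p (z + h) + p (-(z - h))) / 2))) z with hg
  have hlsc : ∀ h, LowerSemicontinuous (g h) := by
    intro h z y hy
    by_cases hz : z ∈ {z | z + h ∈ Ω ∧ z - h ∈ Ω}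
    · have hopen : IsOpen {z | z + h ∈ Ω ∧ z - h ∈ Ω} :=
        (hΩo.preimage (by fun_prop : Continuous fun z => z + h)).inter
          (hΩo.preimage (by fun_prop : Continuous fun z => z - h))
      have hc : Continuous fun z =>
          ENNReal.ofReal (Real.exp (-(p (z + h) + p (-(z - h))) / 2)) :=
        ENNReal.continuous_ofReal.comp (by fun_prop)
      simp only [hg, indicator_of_mem hz] at hy
      filter_upwards [hopen.mem_nhds hz, hc.continuousAt.eventually (lt_mem_nhds hy)] with z' h1 h2
      change y < _
      simp only [hg]
      rwa [indicator_of_mem (show z' ∈ {z | z + h ∈ Ω ∧ z - h ∈ Ω} from h1)]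
    · simp only [hg, indicator_of_notMem hz] at hy
      exact absurd hy not_lt_zero
  have hmeas : Measurable fun z => ⨆ h, g h z := (lowerSemicontinuous_iSup hlsc).measurable
  refine ⟨fun z => ⨆ h, g h z, hmeas, ?_, ?_⟩
  · intro z c hc
    refine iSup_le fun h => ?_
    by_cases hz : z ∈ {z | z + h ∈ Ω ∧ z - h ∈ Ω}
    · simp only [hg, indicator_of_mem hz]
      exact hc _ hz.1 _ hz.2 (by rw [two_smul]; abel)
    · simp only [hg, indicator_of_notMem hz]
      exact zero_le
  · have hF : Measurable (Ω.indicator fun x => ENNReal.ofReal (Real.exp (-p x))) :=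
      Measurable.indicator (by have := hp.measurable; fun_prop) hΩo.measurableSet
    have key := prekopaLeindler_euclideanSpace n
      (Ω.indicator fun x => ENNReal.ofReal (Real.exp (-p x)))
      (fun y => Ω.indicator (fun x => ENNReal.ofReal (Real.exp (-p x))) (-y))
      (Ω.indicator fun z => ⨆ h, g h z) hF (hF.comp measurable_neg)
      (hmeas.indicator hΩo.measurableSet) ?_
    · rw [lintegral_neg_eq_self, lintegral_indicator hΩo.measurableSet,
        lintegral_indicator hΩo.measurableSet, ← sq] at key
      exact (ENNReal.pow_le_pow_left_iff two_ne_zero).1 key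
    · intro x y
      by_cases hx : x ∈ Ω
      · by_cases hy : -y ∈ Ω
        · have hy' : y ∈ Ω := by simpa using hΩneg _ hy
          have hz : (2⁻¹ : ℝ) • (x + y) ∈ Ω := by
            rw [smul_add]
            exact hΩc hx hy' (by norm_num) (by norm_num) (by norm_num)
          rw [indicator_of_mem hx, indicator_of_mem hy, indicator_of_mem hz]
          set z := (2⁻¹ : ℝ) • (x + y) with hzdef
          set h := (2⁻¹ : ℝ) • (x - y) with hhdef
          have e1 : z + h = x := by rw [hzdef, hhdef]; module
          have e2 : z - h = y := by rw [hzdef, hhdef]; module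
          have hmem : z ∈ {z | z + h ∈ Ω ∧ z - h ∈ Ω} := by
            refine ⟨?_, ?_⟩
            · rwa [e1]
            · rwa [e2]
          have hle : ENNReal.ofReal (Real.exp (-(p x + p (-y)) / 2)) ≤ ⨆ h, g h z := by
            refine le_trans (le_of_eq ?_) (le_iSup (fun h => g h z) h)
            simp only [hg, indicator_of_mem hmem, e1, e2]
          refine le_trans (le_of_eq ?_) (pow_le_pow_left' hle 2)
          rw [← ENNReal.ofReal_mul (Real.exp_pos _).le, ← ENNReal.ofReal_pow (Real.exp_pos _).le,
            ← Real.exp_add, ← Real.exp_nat_mul]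
          congr 2
          push_cast
          ring
        · rw [indicator_of_notMem hy, mul_zero]
          exact zero_le
      · rw [indicator_of_notMem hx, zero_mul]
        exact zero_le

theorem one_add_sq_div_two_le_cosh (t : ℝ) : 1 + t ^ 2 / 2 ≤ Real.cosh t := by
  have h1 : Real.cosh t = 1 + 2 * Real.sinh (t / 2) ^ 2 := by
    have := Real.cosh_two_mul (t / 2)
    rw [mul_div_cancel₀ t two_ne_zero, Real.cosh_sq] at this
    linarith
  have h2 : (t / 2) ^ 2 ≤ Real.sinh (t / 2) ^ 2 := by
    rw [sq_le_sq]
    rcases le_total 0 (t / 2) with h | h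
    · rw [abs_of_nonneg h]
      exact (Real.self_le_sinh_iff.2 h).trans (le_abs_self _)
    · rw [abs_of_nonpos h, ← abs_neg (Real.sinh _), ← Real.sinh_neg]
      exact (Real.self_le_sinh_iff.2 (neg_nonneg.2 h)).trans (le_abs_self _)
  rw [h1]
  linarith

theorem exp_midpoint_mul_le (a b : ℝ) :
    Real.exp ((a + b) / 2) * (1 + (a - b) ^ 2 / 8) ≤ (Real.exp a + Real.exp b) / 2 := by
  have h1 : (Real.exp a + Real.exp b) / 2 = Real.exp ((a + b) / 2) * Real.cosh ((a - b) / 2) := by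
    rw [Real.cosh_eq, mul_div_assoc', mul_add, ← Real.exp_add, ← Real.exp_add]
    ring_nf
  rw [h1]
  gcongr
  exact one_add_sq_div_two_le_cosh _ |>.trans' (by ring_nf; rfl)

/-- Optimizing over the displacement `k = (x - y) / 2 + δ e`, the exponent in the sup-convolution
exceeds `-W` by at most a multiple of `δ ^ 2`, uniformly in the base point. -/
theorem exponent_le_uniform {W f : Rn n → ℝ} {ε : ℝ} (hε : 0 < ε)
    (hWε : ∀ x h, ε * ‖h‖ ^ 2 ≤ W (x + h) + W (x - h) - 2 * W x) {L : NNReal}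
    (hf : LipschitzWith L f) (e : Rn n) {δ : ℝ} (hδ : 0 ≤ δ) {x y z : Rn n}
    (hxy : x + y = (2 : ℝ) • z) :
    -(W (x + δ • e) + W (y - δ • e) - δ * (f x - f y)) / 2 ≤
        -W z + δ ^ 2 * (L ^ 2 / (2 * ε) + L * ‖e‖) := by
  set k := (2⁻¹ : ℝ) • (x - y) + δ • e with hk
  have hx : z + k = x + δ • e := by
    have : z = (2⁻¹ : ℝ) • (x + y) := by rw [hxy]; module
    rw [this, hk]; module
  have hy : z - k = y - δ • e := by
    have : z = (2⁻¹ : ℝ) • (x + y) := by rw [hxy]; module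
    rw [this, hk]; module
  have hxy' : x - y = (2 : ℝ) • (k - δ • e) := by rw [hk]; module
  have h1 := hWε z k
  rw [hx, hy] at h1
  have h2 : f x - f y ≤ 2 * L * (‖k‖ + δ * ‖e‖) := by
    have h3 := hf.dist_le_mul x y
    rw [Real.dist_eq, dist_eq_norm, hxy', norm_smul, Real.norm_ofNat] at h3
    have h4 : ‖k - δ • e‖ ≤ ‖k‖ + δ * ‖e‖ := by
      refine (norm_sub_le _ _).trans_eq ?_
      rw [norm_smul, Real.norm_of_nonneg hδ]
    calc f x - f y ≤ L * (2 * ‖k - δ • e‖) := (le_abs_self _).trans h3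
      _ ≤ L * (2 * (‖k‖ + δ * ‖e‖)) := by gcongr
      _ = _ := by ring
  have h5 := mul_le_mul_of_nonneg_left h2 hδ
  have h6 : -(ε * ‖k‖ ^ 2) / 2 + δ * L * ‖k‖ ≤ δ ^ 2 * (L ^ 2 / (2 * ε)) := by
    rw [← sub_nonneg]
    have : δ ^ 2 * (L ^ 2 / (2 * ε)) - (-(ε * ‖k‖ ^ 2) / 2 + δ * L * ‖k‖) =
        (ε * ‖k‖ - δ * L) ^ 2 / (2 * ε) := by field_simp; ring
    rw [this]
    positivity
  nlinarith

/-- The pointwise second-order bound for the exponent in the sup-convolution. Large displacements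
are excluded by the uniform convexity of `W`; for displacements of order `δ` the expansions of `W`
and `f` at the base point apply. -/
theorem eventually_exponent_le {W f : Rn n → ℝ} {ε : ℝ} (hε : 0 < ε)
    (hWε : ∀ x h, ε * ‖h‖ ^ 2 ≤ W (x + h) + W (x - h) - 2 * W x)
    (hW : Differentiable ℝ W) {L : NNReal} (hf : LipschitzWith L f) (e : Rn n) {z : Rn n}
    (hW2 : DifferentiableAt ℝ (fderiv ℝ W) z) (hfz : DifferentiableAt ℝ f z) {q : ℝ}
    (hq : ∀ k, 2 * fderiv ℝ f z k ≤ q + fderiv ℝ (fderiv ℝ W) z k k) {η : ℝ} (hη : 0 < η) :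
    ∀ᶠ δ in 𝓝[>] (0 : ℝ), ∀ x y, x + y = (2 : ℝ) • z →
      -(W (x + δ • e) + W (y - δ • e) - δ * (f x - f y)) / 2 ≤
        -W z + δ ^ 2 * (q / 2 - fderiv ℝ f z e + η) := by
  have hq0 : 0 ≤ q := by simpa using hq 0
  have hfe : fderiv ℝ f z e ≤ L * ‖e‖ :=
    (le_abs_self _).trans ((fderiv ℝ f z).le_of_opNorm_le (norm_fderiv_le_of_lipschitz ℝ hf) e)
  -- Displacements longer than `R δ` cost more than they gain; `τ` is the accuracy needed of the
  -- expansions for displacements shorter than that.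
  obtain ⟨R, hR0, hR1, hR2⟩ : ∃ R : ℝ, 0 ≤ R ∧ 2 * (L + 1) / ε ≤ R ∧ 2 * L * ‖e‖ ≤ R :=
    ⟨max (2 * (L + 1) / ε) (2 * L * ‖e‖), le_max_of_le_right (by positivity), le_max_left _ _,
      le_max_right _ _⟩
  obtain ⟨τ, hτ0, hτη⟩ : ∃ τ : ℝ, 0 < τ ∧ τ * (R ^ 2 + R + ‖e‖ + 1) = η :=
    ⟨η / (R ^ 2 + R + ‖e‖ + 1), by positivity, by field_simp⟩
  obtain ⟨r, hr, hball⟩ := Metric.eventually_nhds_iff.1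
    ((eventually_abs_secondDifference_le hW hW2 hτ0).and
      ((hasFDerivAt_iff_isLittleO_nhds_zero.1 hfz.hasFDerivAt).def hτ0))
  have hr' : 0 < r / (R + ‖e‖ + 1) := by positivity
  filter_upwards [Ioo_mem_nhdsGT hr'] with δ hδ x y hxy
  have hδ0 := hδ.1
  have hδr : δ * (R + ‖e‖ + 1) < r := (lt_div_iff₀ (by positivity)).1 hδ.2
  set k := (2⁻¹ : ℝ) • (x - y) + δ • e with hk
  have hz : z = (2⁻¹ : ℝ) • (x + y) := by rw [hxy]; module
  have hx : z + k = x + δ • e := by rw [hz, hk]; module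
  have hy : z - k = y - δ • e := by rw [hz, hk]; module
  have hx' : z + (k - δ • e) = x := by rw [hz, hk]; module
  have hy' : z + -(k - δ • e) = y := by rw [hz, hk]; module
  have hxy' : x - y = (2 : ℝ) • (k - δ • e) := by rw [hk]; module
  have hkδ : ‖k - δ • e‖ ≤ ‖k‖ + δ * ‖e‖ := by
    refine (norm_sub_le _ _).trans_eq ?_
    rw [norm_smul, Real.norm_of_nonneg hδ0.le]
  rcases le_or_gt (R * δ) ‖k‖ with hbig | hsmall
  · have h1 := hWε z k
    rw [hx, hy] at h1
    have h2 : f x - f y ≤ 2 * L * (‖k‖ + δ * ‖e‖) := by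
      have h3 := hf.dist_le_mul x y
      rw [Real.dist_eq, dist_eq_norm, hxy', norm_smul, Real.norm_ofNat] at h3
      calc f x - f y ≤ L * (2 * ‖k - δ • e‖) := (le_abs_self _).trans h3
        _ ≤ L * (2 * (‖k‖ + δ * ‖e‖)) := by gcongr
        _ = _ := by ring
    have h5 := mul_le_mul_of_nonneg_left h2 hδ0.le
    have h6 : δ * (L + 1) ≤ ε * ‖k‖ / 2 := by
      have : δ * (2 * (L + 1) / ε) ≤ ‖k‖ := by
        refine le_trans ?_ hbig
        rw [mul_comm R]
        gcongr
      rw [mul_div_assoc', div_le_iff₀ hε] at this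
      linarith
    have h7 : 2 * L * ‖e‖ * δ ≤ ‖k‖ := by
      refine le_trans ?_ hbig
      gcongr
    have h8 := mul_le_mul_of_nonneg_right h6 (norm_nonneg k)
    have h9 := mul_le_mul_of_nonneg_left h7 hδ0.le
    have h10 : 0 ≤ δ ^ 2 * (q / 2 + η) := by positivity
    have h11 := mul_le_mul_of_nonneg_left hfe (sq_nonneg δ)
    nlinarith
  · have hkr : ‖k‖ < r := by nlinarith [norm_nonneg e]
    have hhr : ‖k - δ • e‖ < r := by nlinarith [norm_nonneg e]
    have hhle : ‖k - δ • e‖ ≤ δ * (R + ‖e‖) := by nlinarith [norm_nonneg e]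
    have h1 := (hball (y := k) (by simpa using hkr)).1
    have h2 := (hball (y := k - δ • e) (by simpa using hhr)).2
    have h3 := (hball (y := -(k - δ • e)) (by rw [dist_zero_right, norm_neg]; exact hhr)).2
    rw [hx, hy] at h1
    rw [hx'] at h2
    rw [hy', norm_neg] at h3
    rw [Real.norm_eq_abs] at h2 h3
    have hqk := hq (δ⁻¹ • k)
    have hqk' : 2 * δ * fderiv ℝ f z k ≤ δ ^ 2 * q + fderiv ℝ (fderiv ℝ W) z k k := by
      have := mul_le_mul_of_nonneg_left hqk (sq_nonneg δ)
      simp only [map_smul, smul_apply, smul_eq_mul] at this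
      field_simp at this
      linarith
    simp only [map_neg, map_sub, map_smul, smul_eq_mul] at h2 h3
    have h1' := (abs_le.1 h1).1
    have h2' := (abs_le.1 h2).2
    have h3' := (abs_le.1 h3).1
    have hk2 : τ * ‖k‖ ^ 2 ≤ τ * (R * δ) ^ 2 := by gcongr
    have hh2 : τ * ‖k - δ • e‖ ≤ τ * (δ * (R + ‖e‖)) := by gcongr
    have h4 : f x - f y ≤ 2 * (fderiv ℝ f z k - δ * fderiv ℝ f z e) +
        2 * (τ * (δ * (R + ‖e‖))) := by linarith
    have h5 := mul_le_mul_of_nonneg_left h4 hδ0.le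
    have h6 : δ ^ 2 * (τ * (R ^ 2 / 2 + (R + ‖e‖))) ≤ δ ^ 2 * η := by
      have : R ^ 2 / 2 + (R + ‖e‖) ≤ R ^ 2 + R + ‖e‖ + 1 := by linarith [sq_nonneg R]
      exact mul_le_mul_of_nonneg_left
        ((mul_le_mul_of_nonneg_left this hτ0.le).trans_eq hτη) (sq_nonneg δ)
    linarith

theorem integral_le_toReal_lintegral_ofReal {α : Type*} [MeasurableSpace α] {μ : Measure α}
    {f : α → ℝ} (hf : Integrable f μ) :
    ∫ x, f x ∂μ ≤ (∫⁻ x, ENNReal.ofReal (f x) ∂μ).toReal := by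
  rw [integral_eq_lintegral_pos_part_sub_lintegral_neg_part hf]
  exact sub_le_self _ ENNReal.toReal_nonneg

/-- Fatou's lemma for real integrals, in `ε`-form. -/
theorem integral_le_of_eventually_le {α : Type*} [MeasurableSpace α] {μ : Measure α}
    [IsFiniteMeasure μ] {Φ : ℕ → α → ℝ} {ℓ : α → ℝ} {B : ℝ} (hΦ : ∀ m, Integrable (Φ m) μ)
    (hΦ0 : ∀ m, ∀ᵐ x ∂μ, 0 ≤ Φ m x) (hℓ : Integrable ℓ μ)
    (hlim : ∀ᵐ x ∂μ, ∀ η > 0, ∀ᶠ m in atTop, ℓ x - η ≤ Φ m x)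
    (hB : ∀ η > 0, ∀ᶠ m in atTop, ∫ x, Φ m x ∂μ ≤ B + η) : ∫ x, ℓ x ∂μ ≤ B := by
  have hB0 : 0 ≤ B := le_of_forall_pos_le_add fun η hη => by
    obtain ⟨m, hm⟩ := (hB η hη).exists
    exact (integral_nonneg_of_ae (hΦ0 m)).trans hm
  have h1 : ∫⁻ x, ENNReal.ofReal (ℓ x) ∂μ ≤ ENNReal.ofReal B := by
    calc ∫⁻ x, ENNReal.ofReal (ℓ x) ∂μ
        ≤ ∫⁻ x, liminf (fun m => ENNReal.ofReal (Φ m x)) atTop ∂μ := by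
          refine lintegral_mono_ae ?_
          filter_upwards [hlim] with x hx
          refine ENNReal.le_of_forall_pos_le_add fun η hη _ => ?_
          have h2 : ENNReal.ofReal (ℓ x - η) ≤ liminf (fun m => ENNReal.ofReal (Φ m x)) atTop :=
            le_liminf_of_le (by isBoundedDefault)
              ((hx η hη).mono fun m hm => ENNReal.ofReal_le_ofReal hm)
          calc ENNReal.ofReal (ℓ x) = ENNReal.ofReal ((ℓ x - η) + η) := by rw [sub_add_cancel]
            _ ≤ ENNReal.ofReal (ℓ x - η) + ENNReal.ofReal η := ENNReal.ofReal_add_le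
            _ ≤ _ := by
              rw [ENNReal.ofReal_coe_nnreal]
              gcongr
      _ ≤ liminf (fun m => ∫⁻ x, ENNReal.ofReal (Φ m x) ∂μ) atTop :=
          lintegral_liminf_le' fun m => (hΦ m).1.aemeasurable.ennreal_ofReal
      _ ≤ ENNReal.ofReal B := by
          refine ENNReal.le_of_forall_pos_le_add fun η hη _ => ?_
          have h3 : ∀ᶠ m in atTop, ∫⁻ x, ENNReal.ofReal (Φ m x) ∂μ ≤ ENNReal.ofReal B + η := by
            filter_upwards [hB η hη] with m hm
            rw [← ofReal_integral_eq_lintegral_ofReal (hΦ m) (hΦ0 m)]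
            refine (ENNReal.ofReal_le_ofReal hm).trans_eq ?_
            rw [ENNReal.ofReal_add hB0 η.coe_nonneg, ENNReal.ofReal_coe_nnreal]
          exact (liminf_le_liminf h3).trans_eq (liminf_const _)
  exact (integral_le_toReal_lintegral_ofReal hℓ).trans
    ((ENNReal.toReal_mono (by simp) h1).trans_eq (ENNReal.toReal_ofReal hB0))

theorem setIntegral_comp_neg {Ω : Set (Rn n)} (hΩneg : ∀ x ∈ Ω, -x ∈ Ω) (g : Rn n → ℝ) :
    ∫ x in Ω, g (-x) = ∫ x in Ω, g x := by
  have hpre : Neg.neg ⁻¹' Ω = Ω := by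
    ext x
    exact ⟨fun h => by simpa using hΩneg _ h, fun h => hΩneg x h⟩
  conv_lhs => rw [← hpre]
  exact (Measure.measurePreserving_neg (volume : Measure (Rn n))).setIntegral_preimage_emb
    (MeasurableEquiv.neg (Rn n)).measurableEmbedding g Ω

/-- One application of the Prékopa–Leindler inequality to `exp (-W (x ± δ e) ± δ f x)` on `Ω`. The
perturbation in the direction `e` is a translation of `W` rather than the first-order term
`δ ∂_e W`, which would have no good second-order expansion when `∂_e W` is not Lipschitz. -/
theorem exists_integral_le_of_perturbation {Ω : Set (Rn n)} (hΩo : IsOpen Ω) (hΩc : Convex ℝ Ω)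
    (hΩb : Bornology.IsBounded Ω) (hΩneg : ∀ x ∈ Ω, -x ∈ Ω) {W f : Rn n → ℝ}
    (hW : Continuous W) (hWeven : ∀ x, W (-x) = W x) (hf : Continuous f)
    (hfodd : ∀ x ∈ Ω, f (-x) = -f x) (e : Rn n) (δ : ℝ) {c : Rn n → ℝ} (hc : Continuous c)
    (hcb : ∀ z ∈ Ω, ∀ x ∈ Ω, ∀ y ∈ Ω, x + y = (2 : ℝ) • z →
        -(W (x + δ • e) + W (y - δ • e) - δ * (f x - f y)) / 2 ≤ c z) :
    ∃ h : Rn n → ℝ, IntegrableOn h Ω ∧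
      (∀ z ∈ Ω, ∀ b, (∀ x y, x + y = (2 : ℝ) • z →
        -(W (x + δ • e) + W (y - δ • e) - δ * (f x - f y)) / 2 ≤ b) → h z ≤ Real.exp b) ∧
      (∀ z ∈ Ω, h z ≤ Real.exp (c z)) ∧
      ∫ x in Ω, Real.exp (-W x) * (1 - (W (x + δ • e) + W (x - δ • e) - 2 * W x) / 2) +
          Real.exp (-(W (x + δ • e) + W (x - δ • e)) / 2) *
            (W (x - δ • e) - W (x + δ • e) + 2 * δ * f x) ^ 2 / 8 ≤
        ∫ x in Ω, h x := by
  set p : Rn n → ℝ := fun x => W (x + δ • e) - δ * f x with hp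
  have hpc : Continuous p := by fun_prop
  have hpneg : ∀ x ∈ Ω, p (-x) = W (x - δ • e) + δ * f x := fun x hx => by
    simp only [hp]
    rw [hfodd x hx, ← hWeven (x - δ • e), neg_sub, sub_eq_add_neg (δ • e), add_comm (δ • e)]
    ring
  obtain ⟨H, hHm, hHle, hHint⟩ := exists_supConvolution hΩo hΩc hΩneg hpc
  have hexp : ∀ x y, y ∈ Ω → -(p x + p (-y)) / 2 =
      -(W (x + δ • e) + W (y - δ • e) - δ * (f x - f y)) / 2 := fun x y hy => by
    rw [hpneg y hy]; simp only [hp]; ring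
  have hle : ∀ z ∈ Ω, ∀ b, (∀ x ∈ Ω, ∀ y ∈ Ω, x + y = (2 : ℝ) • z →
      -(W (x + δ • e) + W (y - δ • e) - δ * (f x - f y)) / 2 ≤ b) →
      H z ≤ ENNReal.ofReal (Real.exp b) := fun z _ b hb =>
    hHle z _ fun x hx y hy hxy => by
      rw [hexp x y hy]
      exact ENNReal.ofReal_le_ofReal (Real.exp_le_exp.2 (hb x hx y hy hxy))
  have hHc : ∀ z ∈ Ω, H z ≤ ENNReal.ofReal (Real.exp (c z)) := fun z hz => hle z hz _ (hcb z hz)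
  have hΩm := hΩo.measurableSet
  have hfin : ∫⁻ z in Ω, H z ≠ ∞ := by
    refine ne_top_of_le_ne_top ?_ (setLIntegral_mono' hΩm hHc)
    exact (Integrable.lintegral_lt_top (integrableOn_of_continuous_of_isBounded
      (by fun_prop : Continuous fun z => Real.exp (c z)) hΩb)).ne
  have hint : IntegrableOn (fun z => (H z).toReal) Ω :=
    integrable_toReal_of_lintegral_ne_top hHm.aemeasurable hfin
  refine ⟨fun z => (H z).toReal, hint, ?_, ?_, ?_⟩
  · intro z hz b hb
    exact ENNReal.toReal_le_of_le_ofReal (Real.exp_pos _).le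
      (hle z hz b fun x _ y _ hxy => hb x y hxy)
  · exact fun z hz => ENNReal.toReal_le_of_le_ofReal (Real.exp_pos _).le (hHc z hz)
  · have i1 : IntegrableOn (fun x => Real.exp (-p x)) Ω :=
      integrableOn_of_continuous_of_isBounded (by fun_prop) hΩb
    have i2 : IntegrableOn (fun x => Real.exp (-p (-x))) Ω :=
      integrableOn_of_continuous_of_isBounded (by fun_prop) hΩb
    calc _ ≤ ∫ x in Ω, (Real.exp (-p x) + Real.exp (-p (-x))) / 2 := by
          refine setIntegral_mono_on (integrableOn_of_continuous_of_isBounded (by fun_prop) hΩb)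
            ((i1.add i2).div_const 2) hΩm fun x hx => ?_
          refine le_trans ?_ (exp_midpoint_mul_le _ _)
          have e1 : (-p x + -p (-x)) / 2 = -(W (x + δ • e) + W (x - δ • e)) / 2 := by
            rw [hpneg x hx]; simp only [hp]; ring
          have e2 : -p x - -p (-x) = W (x - δ • e) - W (x + δ • e) + 2 * δ * f x := by
            rw [hpneg x hx]; simp only [hp]; ring
          rw [e1, e2, mul_add, mul_one, mul_div_assoc]
          gcongr
          have e3 : -(W (x + δ • e) + W (x - δ • e)) / 2 =
              -W x + -((W (x + δ • e) + W (x - δ • e) - 2 * W x) / 2) := by ring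
          rw [e3, Real.exp_add]
          gcongr
          have := Real.add_one_le_exp (-((W (x + δ • e) + W (x - δ • e) - 2 * W x) / 2))
          linarith
      _ = ∫ x in Ω, Real.exp (-p x) := by
          rw [integral_div, integral_add i1 i2,
            setIntegral_comp_neg hΩneg (fun x => Real.exp (-p x))]
          ring
      _ ≤ ∫ x in Ω, (H x).toReal := by
          rw [integral_toReal hHm.aemeasurable (ae_lt_top hHm hfin),
            integral_eq_lintegral_of_nonneg_ae (.of_forall fun x => (Real.exp_pos _).le) i1.1]
          exact ENNReal.toReal_mono hfin hHint

theorem tendsto_exp_mul_sq_sub_one_div (C : ℝ) :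
    Tendsto (fun δ : ℝ => (Real.exp (C * δ ^ 2) - 1) / δ ^ 2) (𝓝[>] 0) (𝓝 C) := by
  have h1 : HasDerivAt (fun s : ℝ => Real.exp (C * s)) C 0 := by
    have := ((hasDerivAt_id (0 : ℝ)).const_mul C).exp
    simpa using this
  have h2 := h1.tendsto_slope
  have h3 : Tendsto (fun δ : ℝ => δ ^ 2) (𝓝[>] 0) (𝓝[≠] 0) := by
    refine tendsto_nhdsWithin_iff.2 ⟨?_, ?_⟩
    · have : Tendsto (fun δ : ℝ => δ ^ 2) (𝓝 0) (𝓝 (0 ^ 2)) := (continuous_pow 2).tendsto 0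
      rw [zero_pow two_ne_zero] at this
      exact this.mono_left nhdsWithin_le_nhds
    · filter_upwards [self_mem_nhdsWithin] with δ hδ
      exact pow_ne_zero 2 (ne_of_gt hδ)
  refine (h2.comp h3).congr fun δ => ?_
  simp [slope_def_field]

/-- The square term produced by the strict convexity of the exponential has the expected limit. -/
theorem tendsto_exp_mul_sq_div {W : Rn n → ℝ} (hW : Differentiable ℝ W) (x e : Rn n) (a : ℝ) :
    Tendsto (fun δ : ℝ => Real.exp (-(W (x + δ • e) + W (x - δ • e)) / 2) *
      (W (x - δ • e) - W (x + δ • e) + 2 * δ * a) ^ 2 / 8 / δ ^ 2) (𝓝[>] 0)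
      (𝓝 (Real.exp (-W x) * (a - fderiv ℝ W x e) ^ 2 / 2)) := by
  have h1 : HasDerivAt (fun δ : ℝ => W (x - δ • e) - W (x + δ • e) + 2 * δ * a)
      (2 * (a - fderiv ℝ W x e)) 0 := by
    have h := ((hasDerivAt_comp_sub_smul hW x e 0).sub (hasDerivAt_comp_add_smul hW x e 0)).add
      (((hasDerivAt_id (0 : ℝ)).const_mul 2).mul_const a)
    refine h.congr_deriv ?_
    simp
    ring
  have h2 : Tendsto (fun δ : ℝ => (W (x - δ • e) - W (x + δ • e) + 2 * δ * a) / δ) (𝓝[>] 0)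
      (𝓝 (2 * (a - fderiv ℝ W x e))) := by
    refine (h1.tendsto_slope.mono_left (nhdsWithin_mono 0 fun δ (hδ : 0 < δ) => hδ.ne')).congr
      fun δ => ?_
    simp [slope_def_field]
  have h3 : Tendsto (fun δ : ℝ => Real.exp (-(W (x + δ • e) + W (x - δ • e)) / 2)) (𝓝[>] 0)
      (𝓝 (Real.exp (-W x))) := by
    have hc : Continuous fun δ : ℝ => Real.exp (-(W (x + δ • e) + W (x - δ • e)) / 2) := by
      have := hW.continuous
      fun_prop
    have := (hc.tendsto 0).mono_left (nhdsWithin_le_nhds (s := Ioi 0))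
    convert this using 3
    simp
  convert (h3.mul (h2.pow 2)).div_const 8 using 1
  · ext δ; ring
  · congr 1; ring

/-- A Brascamp–Lieb inequality on a bounded symmetric convex open set, for the odd function
`f - ∂_e W`. The quadratic form `⟨(D²W)⁻¹ ∇f, ∇f⟩` enters through any upper bound `q` of
`2 ∂_k f - D²W (k, k)`. -/
theorem integral_sq_sub_fderiv_le {Ω : Set (Rn n)} (hΩo : IsOpen Ω) (hΩc : Convex ℝ Ω)
    (hΩb : Bornology.IsBounded Ω) (hΩneg : ∀ x ∈ Ω, -x ∈ Ω) {W f : Rn n → ℝ} {ε : ℝ} (hε : 0 < ε)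
    (hWε : ∀ x h, ε * ‖h‖ ^ 2 ≤ W (x + h) + W (x - h) - 2 * W x)
    (hWeven : ∀ x, W (-x) = W x) (hW : Differentiable ℝ W) (hW2 : Differentiable ℝ (fderiv ℝ W))
    {L : NNReal} (hf : LipschitzWith L f) (hfd : ∀ x ∈ Ω, DifferentiableAt ℝ f x)
    (hfodd : ∀ x ∈ Ω, f (-x) = -f x) (e : Rn n) {q : Rn n → ℝ} (hqi : IntegrableOn q Ω)
    (hq : ∀ x ∈ Ω, ∀ k, 2 * fderiv ℝ f x k ≤ q x + fderiv ℝ (fderiv ℝ W) x k k) :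
    ∫ x in Ω, Real.exp (-W x) * ((f x - fderiv ℝ W x e) ^ 2 + 2 * fderiv ℝ f x e -
        fderiv ℝ (fderiv ℝ W) x e e) ≤ ∫ x in Ω, Real.exp (-W x) * q x := by
  have hΩm := hΩo.measurableSet
  have hWc := hW.continuous
  have hW'c := hW2.continuous
  have hfc := hf.continuous
  have hD : ∀ x h, 0 ≤ W (x + h) + W (x - h) - 2 * W x := fun x h =>
    (by positivity : 0 ≤ ε * ‖h‖ ^ 2).trans (hWε x h)
  have hnn := fun x => fderiv_fderiv_nonneg hW hW2 hD x e
  have : IsFiniteMeasure (volume.restrict Ω) :=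
    ⟨by rw [Measure.restrict_apply_univ]; exact hΩb.measure_lt_top⟩
  have hmulint : ∀ g : Rn n → ℝ, IntegrableOn g Ω →
      IntegrableOn (fun x => Real.exp (-W x) * g x) Ω := fun g hg =>
    hg.continuous_mul_of_isBounded (by fun_prop : Continuous fun x => Real.exp (-W x)) hΩm hΩb
  have hfe : IntegrableOn (fun x => fderiv ℝ f x e) Ω := by
    refine Integrable.of_bound (measurable_fderiv_apply_const ℝ f e).aestronglyMeasurable
      (L * ‖e‖) (.of_forall fun x => ?_)
    exact (fderiv ℝ f x).le_of_opNorm_le (norm_fderiv_le_of_lipschitz ℝ hf) e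
  have hWee : IntegrableOn (fun x => fderiv ℝ (fderiv ℝ W) x e e) Ω :=
    integrableOn_fderiv_fderiv_of_isBounded hW2 hnn hΩb
  have hexpi : IntegrableOn (fun x => Real.exp (-W x)) Ω :=
    integrableOn_of_continuous_of_isBounded (by fun_prop) hΩb
  set C : ℝ := L ^ 2 / (2 * ε) + L * ‖e‖ with hC
  set δ : ℕ → ℝ := fun m => 1 / ((m : ℝ) + 1) with hδ
  have hδ0 : ∀ m, 0 < δ m := fun m => by positivity
  have hδt : Tendsto δ atTop (𝓝[>] 0) :=
    tendsto_nhdsWithin_iff.2 ⟨tendsto_one_div_add_atTop_nhds_zero_nat, .of_forall hδ0⟩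
  have hstep := fun m => exists_integral_le_of_perturbation hΩo hΩc hΩb hΩneg hWc hWeven hfc hfodd
    e (δ m) (c := fun z => -W z + δ m ^ 2 * C) (by fun_prop)
    (fun z _ x _ y _ hxy => exponent_le_uniform hε hWε hf e (hδ0 m).le hxy)
  choose h hhint hhle hhC hhmain using hstep
  set D : ℕ → Rn n → ℝ := fun m x => W (x + δ m • e) + W (x - δ m • e) - 2 * W x with hDdef
  set P : ℕ → Rn n → ℝ := fun m x => Real.exp (-(W (x + δ m • e) + W (x - δ m • e)) / 2) *
      (W (x - δ m • e) - W (x + δ m • e) + 2 * δ m * f x) ^ 2 / 8 with hPdef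
  have hPint : ∀ m, IntegrableOn (P m) Ω := fun m =>
    integrableOn_of_continuous_of_isBounded (by fun_prop) hΩb
  have hexpC : ∀ m x, Real.exp (-W x + δ m ^ 2 * C) = Real.exp (-W x) * Real.exp (C * δ m ^ 2) :=
    fun m x => by rw [Real.exp_add, mul_comm C]
  -- Both summands are nonnegative: the first is the gain from the strict convexity of `exp`, the
  -- second the distance of the sup-convolution `h m` from its uniform upper bound.
  set Φ : ℕ → Rn n → ℝ := fun m x =>
    P m x / δ m ^ 2 + (Real.exp (-W x) * Real.exp (C * δ m ^ 2) - h m x) / δ m ^ 2 with hΦ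
  have hΦint : ∀ m, IntegrableOn (Φ m) Ω := fun m =>
    ((hPint m).div_const _).add (((hexpi.mul_const _).sub (hhint m)).div_const _)
  set I : ℝ := ∫ x in Ω, Real.exp (-W x) * fderiv ℝ (fderiv ℝ W) x e e with hI
  set Z : ℝ := ∫ x in Ω, Real.exp (-W x) with hZ
  have key := integral_le_of_eventually_le (μ := volume.restrict Ω) (Φ := Φ)
    (ℓ := fun x => Real.exp (-W x) * (f x - fderiv ℝ W x e) ^ 2 / 2 +
      Real.exp (-W x) * (C - (q x / 2 - fderiv ℝ f x e))) (B := C * Z + I / 2) hΦint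
    ?_ ?_ ?_ ?_
  · have i2 : IntegrableOn (fun x => Real.exp (-W x) * ((f x - fderiv ℝ W x e) ^ 2 +
        2 * fderiv ℝ f x e - fderiv ℝ (fderiv ℝ W) x e e)) Ω :=
      hmulint _ (((integrableOn_of_continuous_of_isBounded (by fun_prop) hΩb).add
        (hfe.const_mul 2)).sub hWee)
    have e1 : ∀ x, Real.exp (-W x) * (f x - fderiv ℝ W x e) ^ 2 / 2 +
        Real.exp (-W x) * (C - (q x / 2 - fderiv ℝ f x e)) =
        (Real.exp (-W x) * ((f x - fderiv ℝ W x e) ^ 2 + 2 * fderiv ℝ f x e -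
          fderiv ℝ (fderiv ℝ W) x e e) / 2 +
        (Real.exp (-W x) * C + Real.exp (-W x) * fderiv ℝ (fderiv ℝ W) x e e / 2)) -
        Real.exp (-W x) * q x / 2 :=
      fun x => by ring
    simp_rw [e1] at key
    have j1 := i2.div_const 2
    have j2 := (hexpi.mul_const C)
    have j3 := (hmulint _ hWee).div_const 2
    have j4 := (hmulint _ hqi).div_const 2
    have j5 := j2.add j3
    have j6 := j1.add j5
    simp only [Pi.add_def] at j5 j6
    rw [integral_sub j6 j4, integral_add j1 j5, integral_add j2 j3,
      integral_div, integral_div, integral_div, integral_mul_const] at key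
    linarith
  · intro m
    filter_upwards [ae_restrict_mem hΩm] with x hx
    have h1 := hhC m x hx
    rw [hexpC] at h1
    have h2 : 0 ≤ P m x := by simp only [hPdef]; positivity
    have h3 : 0 ≤ Real.exp (-W x) * Real.exp (C * δ m ^ 2) - h m x := sub_nonneg.2 h1
    positivity
  · have i1 : IntegrableOn (fun x => Real.exp (-W x) * (f x - fderiv ℝ W x e) ^ 2 / 2) Ω :=
      integrableOn_of_continuous_of_isBounded (by fun_prop) hΩb
    exact i1.add (hmulint _ ((integrable_const C).sub ((hqi.div_const 2).sub hfe)))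
  · filter_upwards [ae_restrict_mem hΩm] with x hx η hη
    have t1 := (tendsto_exp_mul_sq_div hW x e (f x)).comp hδt
    set b := q x / 2 - fderiv ℝ f x e with hb
    set τ := η / (4 * Real.exp (-W x)) with hτ
    have hτ0 : 0 < τ := by positivity
    have t2 := eventually_exponent_le hε hWε hW hf e (hW2 x) (hfd x hx) (hq x hx) hτ0
    have t3 := (((tendsto_exp_mul_sq_sub_one_div C).sub
      (tendsto_exp_mul_sq_sub_one_div (b + τ))).const_mul (Real.exp (-W x))).comp hδt
    have t4 := t1.add t3
    have hlt : Real.exp (-W x) * (f x - fderiv ℝ W x e) ^ 2 / 2 + Real.exp (-W x) * (C - b) - η <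
        Real.exp (-W x) * (f x - fderiv ℝ W x e) ^ 2 / 2 + Real.exp (-W x) * (C - (b + τ)) := by
      have : Real.exp (-W x) * τ = η / 4 := by rw [hτ]; field_simp
      nlinarith
    filter_upwards [t4.eventually (lt_mem_nhds hlt), hδt.eventually t2] with m hm1 hm2
    refine hm1.le.trans ?_
    have h1 := hhle m x hx _ hm2
    rw [Real.exp_add, mul_comm (δ m ^ 2)] at h1
    simp only [Function.comp_apply, hΦ, hPdef]
    refine add_le_add le_rfl ?_
    rw [← sub_div, mul_div_assoc']
    gcongr
    linarith
  · intro η hη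
    have t1 := (tendsto_exp_mul_sq_sub_one_div C).comp hδt
    have t2 := eventually_integral_secondDifference_le hW hW2 (e := e) hD hΩm hΩb
      (hΩc.addHaar_frontier volume) (w := fun x => Real.exp (-W x)) (by fun_prop)
      (fun x => (Real.exp_pos _).le) hη
    have t3 := t1.mul_const Z
    filter_upwards [t3.eventually (gt_mem_nhds (by linarith : C * Z < C * Z + η / 2)),
      hδt.eventually t2] with m hm1 hm2
    have hδ2 : 0 < δ m ^ 2 := pow_pos (hδ0 m) 2
    have iD : IntegrableOn (fun x => Real.exp (-W x) * D m x) Ω :=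
      integrableOn_of_continuous_of_isBounded (by fun_prop) hΩb
    have hm3 := hhmain m
    have e1 : ∀ x, Real.exp (-W x) * (1 - (W (x + δ m • e) + W (x - δ m • e) - 2 * W x) / 2) +
          Real.exp (-(W (x + δ m • e) + W (x - δ m • e)) / 2) *
            (W (x - δ m • e) - W (x + δ m • e) + 2 * δ m * f x) ^ 2 / 8 =
        Real.exp (-W x) - Real.exp (-W x) * D m x / 2 + P m x := fun x => by
      simp only [hDdef, hPdef]; ring
    simp_rw [e1] at hm3
    have iS := hexpi.sub (iD.div_const 2)
    simp only [Pi.sub_def] at iS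
    rw [integral_add iS (hPint m), integral_sub hexpi (iD.div_const 2),
      integral_div] at hm3
    have e2 : ∫ x in Ω, Φ m x = (∫ x in Ω, P m x) / δ m ^ 2 +
        (Z * Real.exp (C * δ m ^ 2) - ∫ x in Ω, h m x) / δ m ^ 2 := by
      simp only [hΦ]
      have iS := ((hexpi.mul_const (Real.exp (C * δ m ^ 2))).sub (hhint m)).div_const (δ m ^ 2)
      simp only [Pi.sub_apply] at iS
      rw [integral_add ((hPint m).div_const _) iS, integral_div (δ m ^ 2) (P m),
        integral_div (δ m ^ 2) (fun x => Real.exp (-W x) * Real.exp (C * δ m ^ 2) - h m x),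
        integral_sub (hexpi.mul_const _) (hhint m), integral_mul_const]
    rw [e2, ← add_div, div_le_iff₀ hδ2]
    simp only [Function.comp_apply] at hm1
    rw [div_mul_eq_mul_div, div_lt_iff₀ hδ2] at hm1
    simp only [hDdef] at hm3
    nlinarith

end BrascampLieb

/-! ### The regularized dual quadratic form -/

section DualForm

variable {n : ℕ}

/-- `⟨(D²V + ε)⁻¹ ∇f, ∇f⟩` at `x`, written as the supremum over `k` of
`2 ∂_k f - D²V (k, k) - ε |k|²`. The supremum runs over a countable dense set, which makes
measurability in `x` immediate; it needs no regularity or invertibility of `D²V`. -/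
noncomputable def regularizedDualForm (V f : Rn n → ℝ) (ε : ℝ) (x : Rn n) : ℝ :=
  ⨆ j : ℕ, (2 * fderiv ℝ f x (TopologicalSpace.denseSeq (Rn n) j) -
    fderiv ℝ (fderiv ℝ V) x (TopologicalSpace.denseSeq (Rn n) j)
      (TopologicalSpace.denseSeq (Rn n) j) - ε * ‖TopologicalSpace.denseSeq (Rn n) j‖ ^ 2)

theorem measurable_regularizedDualForm (V f : Rn n → ℝ) (ε : ℝ) :
    Measurable (regularizedDualForm V f ε) :=
  Measurable.iSup fun _ => (((measurable_fderiv_apply_const ℝ f _).const_mul 2).sub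
    (measurable_fderiv_fderiv_apply V _ _)).sub_const _

variable {V f : Rn n → ℝ} {ε : ℝ} {x : Rn n}

theorem two_mul_fderiv_sub_le (hε : 0 < ε) (hV : ∀ k, 0 ≤ fderiv ℝ (fderiv ℝ V) x k k) (k : Rn n) :
    2 * fderiv ℝ f x k - fderiv ℝ (fderiv ℝ V) x k k - ε * ‖k‖ ^ 2 ≤ ‖fderiv ℝ f x‖ ^ 2 / ε := by
  have h1 : fderiv ℝ f x k ≤ ‖fderiv ℝ f x‖ * ‖k‖ :=
    (le_abs_self _).trans ((fderiv ℝ f x).le_opNorm k)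
  have h2 := hV k
  rw [le_div_iff₀ hε]
  nlinarith [sq_nonneg (‖fderiv ℝ f x‖ - ε * ‖k‖)]

theorem regularizedDualForm_le (hε : 0 < ε) (hV : ∀ k, 0 ≤ fderiv ℝ (fderiv ℝ V) x k k) :
    regularizedDualForm V f ε x ≤ ‖fderiv ℝ f x‖ ^ 2 / ε :=
  ciSup_le fun _ => two_mul_fderiv_sub_le hε hV _

theorem le_regularizedDualForm (hε : 0 < ε) (hV : ∀ k, 0 ≤ fderiv ℝ (fderiv ℝ V) x k k) (k : Rn n) :
    2 * fderiv ℝ f x k - fderiv ℝ (fderiv ℝ V) x k k - ε * ‖k‖ ^ 2 ≤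
      regularizedDualForm V f ε x := by
  have hclosed : IsClosed {k : Rn n | 2 * fderiv ℝ f x k - fderiv ℝ (fderiv ℝ V) x k k -
      ε * ‖k‖ ^ 2 ≤ regularizedDualForm V f ε x} :=
    isClosed_le (by fun_prop) continuous_const
  have hbdd : BddAbove (range fun j : ℕ => (2 * fderiv ℝ f x (TopologicalSpace.denseSeq (Rn n) j) -
      fderiv ℝ (fderiv ℝ V) x (TopologicalSpace.denseSeq (Rn n) j)
      (TopologicalSpace.denseSeq (Rn n) j) - ε * ‖TopologicalSpace.denseSeq (Rn n) j‖ ^ 2)) :=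
    ⟨_, by rintro _ ⟨j, rfl⟩; exact two_mul_fderiv_sub_le hε hV _⟩
  have hsub : range (TopologicalSpace.denseSeq (Rn n)) ⊆
      {k : Rn n | 2 * fderiv ℝ f x k - fderiv ℝ (fderiv ℝ V) x k k -
      ε * ‖k‖ ^ 2 ≤ regularizedDualForm V f ε x} := by
    rintro _ ⟨j, rfl⟩
    exact le_ciSup hbdd j
  exact ((TopologicalSpace.denseRange_denseSeq (Rn n)).closure_eq ▸
    closure_minimal hsub hclosed) (mem_univ k)

theorem regularizedDualForm_nonneg (hε : 0 < ε) (hV : ∀ k, 0 ≤ fderiv ℝ (fderiv ℝ V) x k k) :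
    0 ≤ regularizedDualForm V f ε x := by
  simpa using le_regularizedDualForm (f := f) hε hV 0

/-- If `∇f = D²V z`, then `⟨(D²V + ε)⁻¹ ∇f, ∇f⟩ ≤ ⟨D²V z, z⟩`, by the Cauchy–Schwarz inequality
for the form `D²V`. -/
theorem regularizedDualForm_le_of_eq (hε : 0 ≤ ε)
    (hV : ∀ k, 0 ≤ fderiv ℝ (fderiv ℝ V) x k k)
    (hsymm : ∀ k l, fderiv ℝ (fderiv ℝ V) x k l = fderiv ℝ (fderiv ℝ V) x l k) {z : Rn n}
    (hz : ∀ k, fderiv ℝ f x k = fderiv ℝ (fderiv ℝ V) x k z) :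
    regularizedDualForm V f ε x ≤ fderiv ℝ (fderiv ℝ V) x z z := by
  refine ciSup_le fun j => ?_
  set k := TopologicalSpace.denseSeq (Rn n) j
  have h1 := hV (k - z)
  simp only [map_sub, _root_.sub_apply] at h1
  rw [hz k]
  have h2 := hsymm k z
  have h3 : 0 ≤ ε * ‖k‖ ^ 2 := by positivity
  linarith

end DualForm

/-! ### Hessian matrices -/

section Hessian

variable {n : ℕ}

theorem hessianMatrix_apply (f : Rn n → ℝ) (x : Rn n) (i j : Fin n) :
    hessianMatrix f x i j = fderiv ℝ (fderiv ℝ f) x (EuclideanSpace.single i 1)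
      (EuclideanSpace.single j 1) := by
  simp [hessianMatrix, iteratedFDeriv_two_apply]

theorem fderiv_fderiv_apply_const {f : Rn n → ℝ} {x : Rn n}
    (hf : DifferentiableAt ℝ (fderiv ℝ f) x) (e k : Rn n) :
    fderiv ℝ (fun y => fderiv ℝ f y e) x k = fderiv ℝ (fderiv ℝ f) x k e := by
  have h := hf.hasFDerivAt.clm_apply (hasFDerivAt_const e x)
  rw [h.fderiv]
  simp

theorem laplacian_eq_sum (f : Rn n → ℝ) (x : Rn n) :
    Δ f x = ∑ i, fderiv ℝ (fderiv ℝ f) x (EuclideanSpace.single i 1)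
      (EuclideanSpace.single i 1) := by
  rw [InnerProductSpace.laplacian_eq_iteratedFDeriv_orthonormalBasis f
    (EuclideanSpace.basisFun (Fin n) ℝ)]
  simp [iteratedFDeriv_two_apply]

theorem gradient_apply (f : Rn n → ℝ) (x : Rn n) (i : Fin n) :
    gradient f x i = fderiv ℝ f x (EuclideanSpace.single i 1) := by
  have h : inner ℝ (gradient f x) (EuclideanSpace.single i (1 : ℝ)) =
      fderiv ℝ f x (EuclideanSpace.single i 1) := by
    simp [gradient]
  rw [← h, EuclideanSpace.inner_single_right]
  simp

theorem opL_eq_sum (V f : Rn n → ℝ) (x : Rn n) :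
    opL V f x = ∑ i, (fderiv ℝ (fderiv ℝ f) x (EuclideanSpace.single i 1)
      (EuclideanSpace.single i 1) - fderiv ℝ f x (EuclideanSpace.single i 1) *
        fderiv ℝ V x (EuclideanSpace.single i 1)) := by
  rw [opL, laplacian_eq_sum, Finset.sum_sub_distrib, PiLp.inner_apply]
  simp [gradient_apply, mul_comm]

theorem norm_gradient_sq (f : Rn n → ℝ) (x : Rn n) :
    ‖gradient f x‖ ^ 2 = ∑ i, fderiv ℝ f x (EuclideanSpace.single i 1) ^ 2 := by
  rw [EuclideanSpace.norm_sq_eq]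
  simp [gradient_apply]

/-- If `∇²V Z = ∇²u`, the `i`-th column `z` of `Z` satisfies `∇(∂ᵢu) = D²V z`, and
`tr (∇²u Z)` is the sum of the values `D²V (z, z)` over the columns. -/
theorem ofReal_sum_regularizedDualForm_le_traceInv {V u : Rn n → ℝ} {ε : ℝ} {x : Rn n} (hε : 0 ≤ ε)
    (hV : ∀ k, 0 ≤ fderiv ℝ (fderiv ℝ V) x k k)
    (hVsymm : ∀ k l, fderiv ℝ (fderiv ℝ V) x k l = fderiv ℝ (fderiv ℝ V) x l k)
    (hu : DifferentiableAt ℝ (fderiv ℝ u) x)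
    (husymm : ∀ k l, fderiv ℝ (fderiv ℝ u) x k l = fderiv ℝ (fderiv ℝ u) x l k) :
    ENNReal.ofReal (∑ i, regularizedDualForm V
      (fun y => fderiv ℝ u y (EuclideanSpace.single i 1)) ε x) ≤
      traceInv (hessianMatrix u x) (hessianMatrix V x) := by
  refine le_iInf₂ fun Z hZ => ENNReal.ofReal_le_ofReal ?_
  set z : Fin n → Rn n := fun i => ∑ j, Z j i • EuclideanSpace.single j (1 : ℝ) with hz
  have key : ∀ (i : Fin n) (k : Rn n), fderiv ℝ (fderiv ℝ u) x k (EuclideanSpace.single i 1) =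
      fderiv ℝ (fderiv ℝ V) x k (z i) := by
    intro i k
    have hlin : (fderiv ℝ (fderiv ℝ u) x).flip (EuclideanSpace.single i 1) =
        (fderiv ℝ (fderiv ℝ V) x).flip (z i) := by
      apply ContinuousLinearMap.coe_injective
      refine (EuclideanSpace.basisFun (Fin n) ℝ).toBasis.ext fun l => ?_
      have h1 := congrFun (congrFun hZ l) i
      rw [Matrix.mul_apply, hessianMatrix_apply] at h1
      simp only [hessianMatrix_apply] at h1
      simp only [OrthonormalBasis.coe_toBasis, EuclideanSpace.basisFun_apply,
        ContinuousLinearMap.coe_coe, ContinuousLinearMap.flip_apply]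
      rw [← h1, hz]
      simp [map_sum, mul_comm]
    have := DFunLike.congr_fun hlin k
    simpa using this
  rw [Matrix.trace]
  refine Finset.sum_le_sum fun i _ => ?_
  refine (regularizedDualForm_le_of_eq (z := z i) hε hV hVsymm fun k => ?_).trans_eq ?_
  · rw [fderiv_fderiv_apply_const hu, key]
  · rw [← key i (z i), Matrix.diag_apply, Matrix.mul_apply, hz]
    simp only [map_sum, map_smul, sum_apply, smul_apply, smul_eq_mul]
    refine Finset.sum_congr rfl fun j _ => ?_
    rw [hessianMatrix_apply, husymm (EuclideanSpace.single j 1), mul_comm]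

end Hessian

section Quadratic

variable {n : ℕ}

/-- The inner product of `ℝⁿ` as a continuous bilinear map over `ℝ`; unlike `innerSL ℝ` it is not
semilinear over `starRingEnd ℝ` in the first variable. -/
noncomputable def innerBilin (n : ℕ) : Rn n →L[ℝ] Rn n →L[ℝ] ℝ :=
  (innerₗ (Rn n)).mkContinuous₂ 1 fun x y => by
    simpa using norm_inner_le_norm (𝕜 := ℝ) x y

@[simp]
theorem innerBilin_apply (x y : Rn n) : innerBilin n x y = inner ℝ x y := rfl

theorem hasFDerivAt_half_norm_sq (ε : ℝ) (x : Rn n) :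
    HasFDerivAt (fun y : Rn n => ε / 2 * ‖y‖ ^ 2) (ε • innerBilin n x) x := by
  refine ((hasStrictFDerivAt_norm_sq x).hasFDerivAt.const_mul (ε / 2)).congr_fderiv ?_
  ext k
  simp
  ring

theorem fderiv_add_half_norm_sq {V : Rn n → ℝ} (hV : Differentiable ℝ V) (ε : ℝ) :
    fderiv ℝ (fun y => V y + ε / 2 * ‖y‖ ^ 2) = fun x => fderiv ℝ V x + ε • innerBilin n x := by
  funext x
  exact ((hV x).hasFDerivAt.add (hasFDerivAt_half_norm_sq ε x)).fderiv

theorem hasFDerivAt_fderiv_add_half_norm_sq {V : Rn n → ℝ} (hV : Differentiable ℝ V)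
    (hV2 : Differentiable ℝ (fderiv ℝ V)) (ε : ℝ) (x : Rn n) :
    HasFDerivAt (fderiv ℝ (fun y => V y + ε / 2 * ‖y‖ ^ 2))
      (fderiv ℝ (fderiv ℝ V) x + ε • innerBilin n) x := by
  rw [fderiv_add_half_norm_sq hV]
  exact (hV2 x).hasFDerivAt.add ((innerBilin n).hasFDerivAt.const_smul ε)

end Quadratic

/-! ### The integrated inequality on an interior domain -/

section InteriorDomain

variable {n : ℕ}

theorem secondDifference_nonneg {V : Rn n → ℝ} (hV : ConvexOn ℝ univ V) (x h : Rn n) :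
    0 ≤ V (x + h) + V (x - h) - 2 * V x := by
  have h1 := hV.2 (mem_univ (x + h)) (mem_univ (x - h)) (by norm_num : (0 : ℝ) ≤ 1 / 2)
    (by norm_num : (0 : ℝ) ≤ 1 / 2) (by norm_num)
  have h2 : (1 / 2 : ℝ) • (x + h) + (1 / 2 : ℝ) • (x - h) = x := by module
  rw [h2, smul_eq_mul, smul_eq_mul] at h1
  linarith

theorem fderiv_neg_eq_neg_of_even {u : Rn n → ℝ} {Ω : Set (Rn n)} (hΩ : IsOpen Ω)
    (hu : ∀ x ∈ Ω, u (-x) = u x) {x : Rn n} (hx : x ∈ Ω) (hux : DifferentiableAt ℝ u (-x)) :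
    fderiv ℝ u (-x) = -fderiv ℝ u x := by
  have h1 : HasFDerivAt (fun y => u (-y)) (-fderiv ℝ u (-x)) x := by
    have := hux.hasFDerivAt.comp x (hasFDerivAt_id x).neg
    refine this.congr_fderiv ?_
    ext k
    simp
  have h2 : (fun y => u (-y)) =ᶠ[𝓝 x] u := by
    filter_upwards [hΩ.mem_nhds hx] with y hy using hu y hy
  rw [← (h2.fderiv_eq), h1.fderiv, neg_neg]

theorem exists_lipschitzOnWith_fderiv {u : Rn n → ℝ} {U S : Set (Rn n)} (hU : IsOpen U)
    (hu : ContDiffOn ℝ 2 u U) (hS : IsCompact S) (hSc : Convex ℝ S) (hSU : S ⊆ U) (e : Rn n) :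
    ∃ L : NNReal, LipschitzOnWith L (fun y => fderiv ℝ u y e) S := by
  have h1 : ContDiffOn ℝ 1 (fun y => fderiv ℝ u y e) U :=
    (hu.fderiv_of_isOpen hU (by norm_num)).clm_apply contDiffOn_const
  have h2 := h1.continuousOn_fderiv_of_isOpen hU le_rfl
  obtain ⟨C, hC⟩ := hS.bddAbove_image (h2.mono hSU).norm
  refine ⟨C.toNNReal, hSc.lipschitzOnWith_of_nnnorm_fderiv_le (𝕜 := ℝ)
    (fun x hx => (h1.differentiableOn (by norm_num)).differentiableAt (hU.mem_nhds (hSU hx)))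
    fun x hx => ?_⟩
  rw [← NNReal.coe_le_coe, coe_nnnorm]
  exact (hC ⟨x, hx, rfl⟩).trans (Real.le_coe_toNNReal C)

theorem differentiableAt_fderiv {u : Rn n → ℝ} {U : Set (Rn n)} (hU : IsOpen U)
    (hu : ContDiffOn ℝ 2 u U) {x : Rn n} (hx : x ∈ U) : DifferentiableAt ℝ (fderiv ℝ u) x :=
  ((hu.fderiv_of_isOpen hU (m := 1) (by norm_num)).differentiableOn (by norm_num)).differentiableAt
    (hU.mem_nhds hx)

/-- The Brascamp–Lieb inequality for `∂_e u - t ∂_e W`, with `W = V + ε |x|² / 2`, on a domain whose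
closure lies in the region where `u` is twice continuously differentiable. -/
theorem integrable_and_integral_le_regularizedDualForm {Ω S U : Set (Rn n)} (hΩo : IsOpen Ω)
    (hΩc : Convex ℝ Ω) (hΩneg : ∀ x ∈ Ω, -x ∈ Ω) (hS : IsCompact S) (hSc : Convex ℝ S)
    (hΩS : Ω ⊆ S) (hU : IsOpen U) (hSU : S ⊆ U) {V : Rn n → ℝ} (hVconvex : ConvexOn ℝ univ V)
    (hVeven : ∀ x, V (-x) = V x) (hV : Differentiable ℝ V) (hV2 : Differentiable ℝ (fderiv ℝ V))
    {u : Rn n → ℝ} (hu : ContDiffOn ℝ 2 u U) (hueven : ∀ x ∈ Ω, u (-x) = u x) {ε : ℝ} (hε : 0 < ε)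
    (t : ℝ) (e : Rn n) :
    IntegrableOn (fun x => Real.exp (-(V x + ε / 2 * ‖x‖ ^ 2)) *
        regularizedDualForm V (fun y => fderiv ℝ u y e) ε x) Ω ∧
    ∫ x in Ω, Real.exp (-(V x + ε / 2 * ‖x‖ ^ 2)) *
      ((fderiv ℝ u x e - t * (fderiv ℝ V x e + ε * inner ℝ x e)) ^ 2 +
        2 * t * fderiv ℝ (fderiv ℝ u) x e e -
        t ^ 2 * (fderiv ℝ (fderiv ℝ V) x e e + ε * ‖e‖ ^ 2)) ≤
      ∫ x in Ω, Real.exp (-(V x + ε / 2 * ‖x‖ ^ 2)) *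
        regularizedDualForm V (fun y => fderiv ℝ u y e) ε x := by
  have hΩb : Bornology.IsBounded Ω := hS.isBounded.subset hΩS
  have hΩm := hΩo.measurableSet
  have hnn := fun x k => fderiv_fderiv_nonneg hV hV2 (secondDifference_nonneg hVconvex) x k
  set f : Rn n → ℝ := fun y => fderiv ℝ u y e with hf
  set W : Rn n → ℝ := fun y => V y + ε / 2 * ‖y‖ ^ 2 with hWdef
  obtain ⟨L, hL⟩ := exists_lipschitzOnWith_fderiv hU hu hS hSc hSU e
  obtain ⟨g, hg, hgf⟩ := hL.extend_real
  have hgev : ∀ x ∈ Ω, g =ᶠ[𝓝 x] f := fun x hx => by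
    filter_upwards [hΩo.mem_nhds hx] with y hy using (hgf (hΩS hy)).symm
  have hu2 : ∀ x ∈ Ω, DifferentiableAt ℝ (fderiv ℝ u) x := fun x hx =>
    differentiableAt_fderiv hU hu (hSU (hΩS hx))
  have hfd : ∀ x ∈ Ω, DifferentiableAt ℝ f x := fun x hx =>
    (hu2 x hx).clm_apply (differentiableAt_const e)
  have hgder : ∀ x ∈ Ω, fderiv ℝ g x = fderiv ℝ f x := fun x hx => (hgev x hx).fderiv_eq
  have hW : Differentiable ℝ W := fun x =>
    ((hV x).hasFDerivAt.add (hasFDerivAt_half_norm_sq ε x)).differentiableAt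
  have hW2 : Differentiable ℝ (fderiv ℝ W) := fun x =>
    (hasFDerivAt_fderiv_add_half_norm_sq hV hV2 ε x).differentiableAt
  have hW2' : ∀ x k, fderiv ℝ (fderiv ℝ W) x k k =
      fderiv ℝ (fderiv ℝ V) x k k + ε * ‖k‖ ^ 2 := fun x k => by
    rw [(hasFDerivAt_fderiv_add_half_norm_sq hV hV2 ε x).fderiv]
    simp
  have hW' : ∀ x k, fderiv ℝ W x k = fderiv ℝ V x k + ε * inner ℝ x k := fun x k => by
    rw [fderiv_add_half_norm_sq hV]
    simp
  have hWε : ∀ x h, ε * ‖h‖ ^ 2 ≤ W (x + h) + W (x - h) - 2 * W x := fun x h => by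
    have h1 := secondDifference_nonneg hVconvex x h
    have h2 := parallelogram_law_with_norm ℝ x h
    simp only [hWdef]
    nlinarith
  have hqi : IntegrableOn (regularizedDualForm V f ε) Ω := by
    have : IsFiniteMeasure (volume.restrict Ω) :=
      ⟨by rw [Measure.restrict_apply_univ]; exact hΩb.measure_lt_top⟩
    refine Integrable.of_bound (measurable_regularizedDualForm V f ε).aestronglyMeasurable
      (L ^ 2 / ε) ?_
    filter_upwards [ae_restrict_mem hΩm] with x hx
    rw [Real.norm_of_nonneg (regularizedDualForm_nonneg hε (hnn x))]
    refine (regularizedDualForm_le hε (hnn x)).trans ?_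
    rw [← hgder x hx]
    gcongr
    exact norm_fderiv_le_of_lipschitz ℝ hg
  refine ⟨?_, ?_⟩
  · exact hqi.continuous_mul_of_isBounded (by have := hW.continuous; fun_prop :
      Continuous fun x => Real.exp (-W x)) hΩm hΩb
  · refine le_trans (le_of_eq ?_) (integral_sq_sub_fderiv_le hΩo hΩc hΩb hΩneg hε hWε
      (fun x => by simp only [hWdef, hVeven, norm_neg]) hW hW2 hg
      (fun x hx => (hgev x hx).differentiableAt_iff.2 (hfd x hx)) (fun x hx => ?_) (t • e) hqi
      (fun x hx k => ?_))
    · refine setIntegral_congr_fun hΩm fun x hx => ?_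
      beta_reduce
      rw [hgder x hx, hW2', map_smul, map_smul, hW', norm_smul, ← hgf (hΩS hx), hf,
        fderiv_fderiv_apply_const (hu2 x hx)]
      simp only [map_smul, smul_apply, smul_eq_mul, mul_pow, Real.norm_eq_abs, sq_abs]
      ring
    · rw [← hgf (hΩS hx), ← hgf (hΩS (hΩneg x hx))]
      simp only
      rw [fderiv_neg_eq_neg_of_even hΩo hueven hx
        ((hu.differentiableOn (by norm_num)).differentiableAt
          (hU.mem_nhds (hSU (hΩS (hΩneg x hx)))))]
      simp
    · rw [hgder x hx, hW2']
      have := le_regularizedDualForm (f := f) hε (hnn x) k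
      linarith

end InteriorDomain

/-! ### Passage to the whole body -/

section Limit

variable {n : ℕ}

/-- Removal of the regularization `ε |x|² / 2` and exhaustion of the domain, by dominated
convergence. -/
theorem tendsto_integral_regularized {Ω : Set (Rn n)} (hΩm : MeasurableSet Ω)
    (hΩb : Bornology.IsBounded Ω) {S : ℕ → Set (Rn n)} (hSm : ∀ m, MeasurableSet (S m))
    (hSΩ : ∀ m, S m ⊆ Ω) (hSt : ∀ x ∈ Ω, ∀ᶠ m in atTop, x ∈ S m) {ε : ℕ → ℝ}
    (hε0 : ∀ m, 0 ≤ ε m) (hε1 : ∀ m, ε m ≤ 1) (hεt : Tendsto ε atTop (𝓝 0)) {V a b c d : Rn n → ℝ}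
    (hV : Continuous V) (e : Rn n) (t : ℝ) (ham : Measurable a)
    (ha : IntegrableOn (fun x => Real.exp (-V x) * a x ^ 2) Ω) (hb : Continuous b)
    (hcm : Measurable c) (hc : IntegrableOn (fun x => Real.exp (-V x) * c x) Ω)
    (hdm : Measurable d) (hd : IntegrableOn (fun x => Real.exp (-V x) * d x) Ω) :
    Tendsto (fun m => ∫ x in S m, Real.exp (-(V x + ε m / 2 * ‖x‖ ^ 2)) *
      ((a x - t * (b x + ε m * inner ℝ x e)) ^ 2 + 2 * t * c x - t ^ 2 * (d x + ε m * ‖e‖ ^ 2)))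
      atTop (𝓝 (∫ x in Ω, Real.exp (-V x) *
        ((a x - t * b x) ^ 2 + 2 * t * c x - t ^ 2 * d x))) := by
  set G : ℕ → Rn n → ℝ := fun m x => Real.exp (-(V x + ε m / 2 * ‖x‖ ^ 2)) *
      ((a x - t * (b x + ε m * inner ℝ x e)) ^ 2 + 2 * t * c x - t ^ 2 * (d x + ε m * ‖e‖ ^ 2))
    with hG
  have e1 : ∀ m, ∫ x in S m, G m x = ∫ x in Ω, (S m).indicator (G m) x := fun m => by
    rw [setIntegral_indicator (hSm m), inter_eq_self_of_subset_right (hSΩ m)]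
  refine Tendsto.congr (fun m => (e1 m).symm) ?_
  have hGm : ∀ m, Measurable (G m) := fun m => by
    have h1 := hV.measurable
    have h2 := hb.measurable
    have h3 : Measurable fun x : Rn n => inner ℝ x e :=
      (by fun_prop : Continuous fun x : Rn n => inner ℝ x e).measurable
    fun_prop
  refine tendsto_integral_of_dominated_convergence
    (fun x => 2 * (Real.exp (-V x) * a x ^ 2) +
      Real.exp (-V x) * (2 * t ^ 2 * (|b x| + |inner ℝ x e|) ^ 2 + t ^ 2 * ‖e‖ ^ 2) +
      2 * |t| * |Real.exp (-V x) * c x| + t ^ 2 * |Real.exp (-V x) * d x|)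
    (fun m => ((hGm m).indicator (hSm m)).aestronglyMeasurable) ?_ ?_ ?_
  · have h1 : Continuous fun x : Rn n => inner ℝ x e := by fun_prop
    have h2 : Continuous fun x => Real.exp (-V x) *
        (2 * t ^ 2 * (|b x| + |inner ℝ x e|) ^ 2 + t ^ 2 * ‖e‖ ^ 2) := by fun_prop
    exact (((ha.const_mul 2).add (integrableOn_of_continuous_of_isBounded h2 hΩb)).add
      (hc.abs.const_mul _)).add (hd.abs.const_mul _)
  · intro m
    refine .of_forall fun x => ?_
    have hb1 : |b x + ε m * inner ℝ x e| ≤ |b x| + |inner ℝ x e| := by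
      refine (abs_add_le _ _).trans (add_le_add le_rfl ?_)
      rw [abs_mul, abs_of_nonneg (hε0 m)]
      exact mul_le_of_le_one_left (abs_nonneg _) (hε1 m)
    have hsq : (a x - t * (b x + ε m * inner ℝ x e)) ^ 2 ≤
        2 * a x ^ 2 + 2 * t ^ 2 * (|b x| + |inner ℝ x e|) ^ 2 := by
      have h1 : (b x + ε m * inner ℝ x e) ^ 2 ≤ (|b x| + |inner ℝ x e|) ^ 2 := by
        rw [← sq_abs (b x + _)]
        gcongr
      have h2 := mul_le_mul_of_nonneg_left h1 (sq_nonneg t)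
      nlinarith [sq_nonneg (a x + t * (b x + ε m * inner ℝ x e))]
    have hm : |(a x - t * (b x + ε m * inner ℝ x e)) ^ 2 + 2 * t * c x -
        t ^ 2 * (d x + ε m * ‖e‖ ^ 2)| ≤ 2 * a x ^ 2 +
        (2 * t ^ 2 * (|b x| + |inner ℝ x e|) ^ 2 + t ^ 2 * ‖e‖ ^ 2) + 2 * |t| * |c x| +
        t ^ 2 * |d x| := by
      have h3 : |2 * t * c x| = 2 * |t| * |c x| := by rw [abs_mul, abs_mul, Nat.abs_ofNat]
      have h4 : |t ^ 2 * (d x + ε m * ‖e‖ ^ 2)| ≤ t ^ 2 * (|d x| + ‖e‖ ^ 2) := by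
        rw [abs_mul, abs_of_nonneg (sq_nonneg t)]
        gcongr
        refine (abs_add_le _ _).trans (add_le_add le_rfl ?_)
        rw [abs_of_nonneg (mul_nonneg (hε0 m) (sq_nonneg _))]
        exact mul_le_of_le_one_left (sq_nonneg _) (hε1 m)
      have h5 := abs_sub ((a x - t * (b x + ε m * inner ℝ x e)) ^ 2 + 2 * t * c x)
        (t ^ 2 * (d x + ε m * ‖e‖ ^ 2))
      have h6 := abs_add_le ((a x - t * (b x + ε m * inner ℝ x e)) ^ 2) (2 * t * c x)
      rw [abs_of_nonneg (sq_nonneg (a x - t * (b x + ε m * inner ℝ x e)))] at h6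
      linarith
    refine (norm_indicator_le_norm_self _ _).trans ?_
    simp only [hG]
    rw [norm_mul, Real.norm_of_nonneg (Real.exp_pos _).le, Real.norm_eq_abs, abs_mul, abs_mul,
      abs_of_pos (Real.exp_pos (-V x))]
    have hexp : Real.exp (-(V x + ε m / 2 * ‖x‖ ^ 2)) ≤ Real.exp (-V x) := by
      have h1 : 0 ≤ ε m / 2 * ‖x‖ ^ 2 := by have := hε0 m; positivity
      rw [Real.exp_le_exp]
      linarith
    calc _ ≤ Real.exp (-V x) * (2 * a x ^ 2 +
        (2 * t ^ 2 * (|b x| + |inner ℝ x e|) ^ 2 + t ^ 2 * ‖e‖ ^ 2) + 2 * |t| * |c x| +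
        t ^ 2 * |d x|) := by gcongr
      _ = _ := by ring
  · filter_upwards [ae_restrict_mem hΩm] with x hx
    have h1 : Tendsto (fun m => G m x) atTop (𝓝 (Real.exp (-V x) *
        ((a x - t * b x) ^ 2 + 2 * t * c x - t ^ 2 * d x))) := by
      have hcont : Continuous fun s : ℝ => Real.exp (-(V x + s / 2 * ‖x‖ ^ 2)) *
        ((a x - t * (b x + s * inner ℝ x e)) ^ 2 + 2 * t * c x - t ^ 2 * (d x + s * ‖e‖ ^ 2)) := by
        fun_prop
      have h2 := (hcont.tendsto 0).comp hεt
      rwa [zero_div, zero_mul, zero_mul, zero_mul, add_zero, add_zero, add_zero] at h2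
    refine h1.congr' ?_
    filter_upwards [hSt x hx] with m hm
    rw [indicator_of_mem hm]

end Limit

section Body

open scoped Pointwise

variable {n : ℕ}

theorem IsSymmConvexBody.zero_mem_interior {K : Set (Rn n)} (hK : IsSymmConvexBody K) :
    (0 : Rn n) ∈ interior K := by
  obtain ⟨x, hx⟩ := hK.interior_nonempty
  have h1 : -x ∈ K := hK.neg_mem x (interior_subset hx)
  have h2 := hK.convex.combo_interior_self_mem_interior hx h1 (by norm_num : (0 : ℝ) < 1 / 2)
    (by norm_num : (0 : ℝ) ≤ 1 / 2) (by norm_num)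
  simpa using h2

theorem IsSymmConvexBody.neg_mem_interior {K : Set (Rn n)} (hK : IsSymmConvexBody K) {x : Rn n}
    (hx : x ∈ interior K) : -x ∈ interior K := by
  have h : Neg.neg ⁻¹' interior K ⊆ interior K :=
    interior_maximal (fun y hy => by simpa using hK.neg_mem _ (interior_subset hy))
      (isOpen_interior.preimage continuous_neg)
  exact h (by simpa using hx)

theorem IsSymmConvexBody.smul_subset_interior {K : Set (Rn n)} (hK : IsSymmConvexBody K) {r : ℝ}
    (hr0 : 0 ≤ r) (hr1 : r < 1) : r • K ⊆ interior K := by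
  rintro _ ⟨x, hx, rfl⟩
  have h := hK.convex.combo_interior_self_mem_interior hK.zero_mem_interior hx
    (sub_pos.2 hr1) hr0 (by ring)
  simpa using h

theorem IsSymmConvexBody.restrict_eq {K : Set (Rn n)} (hK : IsSymmConvexBody K) :
    (volume : Measure (Rn n)).restrict K = volume.restrict (interior K) :=
  Measure.restrict_congr_set
    (interior_ae_eq_of_null_frontier (hK.convex.addHaar_frontier volume)).symm

theorem IsSymmConvexBody.expMeasure_restrict_eq {K : Set (Rn n)} (hK : IsSymmConvexBody K)
    (V : Rn n → ℝ) : (expMeasure V).restrict K =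
      (volume.restrict (interior K)).withDensity fun x => ENNReal.ofReal (Real.exp (-V x)) := by
  rw [expMeasure, restrict_withDensity hK.isCompact.measurableSet, hK.restrict_eq]

theorem IsSymmConvexBody.integrableOn_expMeasure_iff {K : Set (Rn n)} (hK : IsSymmConvexBody K)
    {V : Rn n → ℝ} (hV : Continuous V) {g : Rn n → ℝ} :
    IntegrableOn g K (expMeasure V) ↔
      IntegrableOn (fun x => Real.exp (-V x) * g x) (interior K) := by
  rw [IntegrableOn, hK.expMeasure_restrict_eq, integrable_withDensity_iff_integrable_smul'
    (by have := hV.measurable; fun_prop) (by simp)]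
  simp [ENNReal.toReal_ofReal, Real.exp_nonneg, IntegrableOn]

theorem IsSymmConvexBody.setIntegral_expMeasure {K : Set (Rn n)} (hK : IsSymmConvexBody K)
    {V : Rn n → ℝ} (hV : Continuous V) (g : Rn n → ℝ) :
    ∫ x in K, g x ∂(expMeasure V) = ∫ x in interior K, Real.exp (-V x) * g x := by
  rw [hK.expMeasure_restrict_eq, integral_withDensity_eq_integral_toReal_smul
    (by have := hV.measurable; fun_prop) (by simp)]
  simp [ENNReal.toReal_ofReal, Real.exp_nonneg]

theorem IsSymmConvexBody.setLIntegral_expMeasure {K : Set (Rn n)} (hK : IsSymmConvexBody K)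
    {V : Rn n → ℝ} (hV : Continuous V) (g : Rn n → ℝ≥0∞) :
    ∫⁻ x in K, g x ∂(expMeasure V) =
      ∫⁻ x in interior K, ENNReal.ofReal (Real.exp (-V x)) * g x := by
  rw [hK.expMeasure_restrict_eq, lintegral_withDensity_eq_lintegral_mul_non_measurable _
    (by have := hV.measurable; fun_prop) (by simp)]
  rfl

theorem IsSymmConvexBody.expMeasure_ne_top {K : Set (Rn n)} (hK : IsSymmConvexBody K)
    {V : Rn n → ℝ} (hV : Continuous V) : expMeasure V K ≠ ∞ := by
  have h := hK.setLIntegral_expMeasure hV (fun _ => 1)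
  rw [setLIntegral_const, one_mul] at h
  rw [h]
  simp_rw [mul_one]
  exact (Integrable.lintegral_lt_top (integrableOn_of_continuous_of_isBounded
      (by fun_prop : Continuous fun z => Real.exp (-V z))
      (hK.isCompact.isBounded.subset interior_subset))).ne

theorem IsSymmConvexBody.expMeasure_ne_zero {K : Set (Rn n)} (hK : IsSymmConvexBody K)
    {V : Rn n → ℝ} (hV : Continuous V) : expMeasure V K ≠ 0 := by
  intro h
  have h1 : (volume : Measure (Rn n)) K = 0 := by
    refine withDensity_absolutelyContinuous' (μ := (volume : Measure (Rn n)))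
      (f := fun x => ENNReal.ofReal (Real.exp (-V x)))
      (by have := hV.measurable; exact Measurable.aemeasurable (by fun_prop)) ?_ h
    exact .of_forall fun x => by simp [Real.exp_pos]
  exact (isOpen_interior.measure_pos volume hK.interior_nonempty).ne'
    (measure_mono_null interior_subset h1)

end Body

/-! ### The quadratic inequality and its optimization -/

section QuadraticInequality

open scoped Pointwise

variable {n : ℕ} {K : Set (Rn n)} {V u : Rn n → ℝ}

theorem integrableOn_fderiv_sq (hu : MemW22C2 K (expMeasure V) u) (i : Fin n) :
    IntegrableOn (fun x => fderiv ℝ u x (EuclideanSpace.single i 1) ^ 2) K (expMeasure V) := by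
  refine Integrable.mono'
    ((memLp_two_iff_integrable_sq_norm hu.memLp_gradient.1).1 hu.memLp_gradient)
    ((measurable_fderiv_apply_const ℝ u _).pow_const 2).aestronglyMeasurable
    (.of_forall fun x => ?_)
  rw [Real.norm_of_nonneg (sq_nonneg _)]
  rw [norm_gradient_sq]
  exact Finset.single_le_sum (f := fun i => fderiv ℝ u x (EuclideanSpace.single i 1) ^ 2)
    (fun _ _ => sq_nonneg _) (Finset.mem_univ i)

theorem integrableOn_fderiv_fderiv (hK : IsSymmConvexBody K) (hV : Continuous V)
    (hu : MemW22C2 K (expMeasure V) u) (i : Fin n) :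
    IntegrableOn (fun x => fderiv ℝ (fderiv ℝ u) x (EuclideanSpace.single i 1)
      (EuclideanSpace.single i 1)) K (expMeasure V) := by
  have : IsFiniteMeasure ((expMeasure V).restrict K) :=
    ⟨by rw [Measure.restrict_apply_univ]; exact (hK.expMeasure_ne_top hV).lt_top⟩
  have h := (hu.memLp_hessian i i).integrable one_le_two
  simp only [hessianMatrix_apply] at h
  exact h

theorem integrableOn_opL (hK : IsSymmConvexBody K) (hV : Differentiable ℝ V)
    (hV2 : Differentiable ℝ (fderiv ℝ V)) (hu : MemW22C2 K (expMeasure V) u) :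
    IntegrableOn (opL V u) K (expMeasure V) := by
  have : IsFiniteMeasure ((expMeasure V).restrict K) :=
    ⟨by rw [Measure.restrict_apply_univ]; exact (hK.expMeasure_ne_top hV.continuous).lt_top⟩
  have e : opL V u = fun x => ∑ i, (fderiv ℝ (fderiv ℝ u) x (EuclideanSpace.single i 1)
      (EuclideanSpace.single i 1) - fderiv ℝ u x (EuclideanSpace.single i 1) *
        fderiv ℝ V x (EuclideanSpace.single i 1)) := funext fun x => opL_eq_sum V u x
  rw [e]
  refine integrable_finsetSum _ fun i _ => ?_
  refine (integrableOn_fderiv_fderiv hK hV.continuous hu i).sub ?_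
  have hc : Continuous fun x => fderiv ℝ V x (EuclideanSpace.single i 1) := by
    have := hV2.continuous
    fun_prop
  obtain ⟨B, hB⟩ := hK.isCompact.bddAbove_image hc.norm.continuousOn
  have h2 : MemLp (fun x => fderiv ℝ u x (EuclideanSpace.single i 1)) 2
      ((expMeasure V).restrict K) :=
    (memLp_two_iff_integrable_sq
      (measurable_fderiv_apply_const ℝ u _).aestronglyMeasurable).2 (integrableOn_fderiv_sq hu i)
  refine Integrable.mul_bdd (c := B) (h2.integrable one_le_two) hc.aestronglyMeasurable ?_
  filter_upwards [ae_restrict_mem hK.isCompact.measurableSet] with x hx using hB ⟨x, hx, rfl⟩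

theorem integrableOn_opL_self (hK : IsSymmConvexBody K) (hVconvex : ConvexOn ℝ univ V)
    (hV : Differentiable ℝ V) (hV2 : Differentiable ℝ (fderiv ℝ V)) :
    IntegrableOn (opL V V) K (expMeasure V) := by
  rw [hK.integrableOn_expMeasure_iff hV.continuous]
  have hb : Bornology.IsBounded (interior K) := hK.isCompact.isBounded.subset interior_subset
  have hVc := hV.continuous
  have hV'c := hV2.continuous
  have e : opL V V = fun x => ∑ i, (fderiv ℝ (fderiv ℝ V) x (EuclideanSpace.single i 1)
      (EuclideanSpace.single i 1) - fderiv ℝ V x (EuclideanSpace.single i 1) *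
        fderiv ℝ V x (EuclideanSpace.single i 1)) := funext fun x => opL_eq_sum V V x
  refine IntegrableOn.continuous_mul_of_isBounded (w := fun x => Real.exp (-V x)) ?_ (by fun_prop)
    isOpen_interior.measurableSet hb
  rw [e]
  exact integrable_finsetSum _ fun i _ => (integrableOn_fderiv_fderiv_of_isBounded hV2
    (fun x => fderiv_fderiv_nonneg hV hV2 (secondDifference_nonneg hVconvex) x _) hb).sub
    (integrableOn_of_continuous_of_isBounded (by fun_prop) hb)

/-- The quadratic inequality in `t` obtained by summing the Brascamp–Lieb inequalities for
`∂ᵢu - t ∂ᵢV`. -/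
theorem integral_le_lintegral_traceInv (hK : IsSymmConvexBody K) (hVconvex : ConvexOn ℝ univ V)
    (hVeven : ∀ x, V (-x) = V x) (hV : Differentiable ℝ V) (hV2 : Differentiable ℝ (fderiv ℝ V))
    (hu : MemW22C2 K (expMeasure V) u) (hueven : ∀ x ∈ K, u (-x) = u x)
    (hfin : ∫⁻ x in K, traceInv (hessianMatrix u x) (hessianMatrix V x) ∂(expMeasure V) ≠ ∞)
    (t : ℝ) :
    ∫ x in K, ‖gradient u x‖ ^ 2 ∂(expMeasure V) + 2 * t * ∫ x in K, opL V u x ∂(expMeasure V) -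
        t ^ 2 * ∫ x in K, opL V V x ∂(expMeasure V) ≤
      (∫⁻ x in K, traceInv (hessianMatrix u x) (hessianMatrix V x) ∂(expMeasure V)).toReal := by
  set Ω := interior K with hΩ
  set e : Fin n → Rn n := fun i => EuclideanSpace.single i 1 with he
  have hΩo : IsOpen Ω := isOpen_interior
  have hΩm := hΩo.measurableSet
  have hΩb : Bornology.IsBounded Ω := hK.isCompact.isBounded.subset interior_subset
  have hVc := hV.continuous
  have hV'c := hV2.continuous
  have hnn := fun x k => fderiv_fderiv_nonneg hV hV2 (secondDifference_nonneg hVconvex) x k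
  set r : ℕ → ℝ := fun m => 1 - 1 / ((m : ℝ) + 2) with hr
  set ε : ℕ → ℝ := fun m => 1 / ((m : ℝ) + 1) with hε
  have hr0 : ∀ m, 0 < r m := fun m => by
    simp only [hr, sub_pos]
    rw [div_lt_one (by positivity)]
    have : (0 : ℝ) ≤ m := by positivity
    linarith
  have hr1 : ∀ m, r m < 1 := fun m => sub_lt_self _ (by positivity)
  have hrt : Tendsto r atTop (𝓝 1) := by
    have h : Tendsto (fun m : ℕ => 1 / ((m : ℝ) + 2)) atTop (𝓝 0) := by
      simp_rw [one_div]
      exact tendsto_inv_atTop_zero.comp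
        (tendsto_atTop_add_const_right _ _ tendsto_natCast_atTop_atTop)
    simpa [hr] using h.const_sub 1
  have hε0 : ∀ m, 0 < ε m := fun m => by positivity
  have hε1 : ∀ m, ε m ≤ 1 := fun m => by
    simp only [hε]
    rw [div_le_one (by positivity)]
    have : (0 : ℝ) ≤ m := by positivity
    linarith
  have hεt : Tendsto ε atTop (𝓝 0) := tendsto_one_div_add_atTop_nhds_zero_nat
  -- The closures of these domains lie in `Ω`, so that the derivatives of `u` are Lipschitz there.
  set S : ℕ → Set (Rn n) := fun m => r m • Ω with hS
  have hSo : ∀ m, IsOpen (S m) := fun m => hΩo.smul₀ (hr0 m).ne'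
  have hSK : ∀ m, S m ⊆ r m • K := fun m => smul_set_mono interior_subset
  have hSΩ : ∀ m, S m ⊆ Ω := fun m =>
    (hSK m).trans (hK.smul_subset_interior (hr0 m).le (hr1 m))
  have hSneg : ∀ m, ∀ x ∈ S m, -x ∈ S m := by
    rintro m _ ⟨x, hx, rfl⟩
    exact ⟨-x, hK.neg_mem_interior hx, smul_neg _ _⟩
  have hSt : ∀ x ∈ Ω, ∀ᶠ m in atTop, x ∈ S m := fun x hx => by
    have h1 : Tendsto (fun m => (r m)⁻¹ • x) atTop (𝓝 ((1 : ℝ)⁻¹ • x)) :=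
      (hrt.inv₀ one_ne_zero).smul_const x
    rw [inv_one, one_smul] at h1
    filter_upwards [h1.eventually (hΩo.mem_nhds hx)] with m hm
    exact (mem_smul_set_iff_inv_smul_mem₀ (hr0 m).ne' _ _).2 hm
  have hu2 : ∀ x ∈ Ω, DifferentiableAt ℝ (fderiv ℝ u) x := fun x hx =>
    differentiableAt_fderiv hΩo hu.contDiffOn hx
  have husymm : ∀ x ∈ Ω, ∀ k l, fderiv ℝ (fderiv ℝ u) x k l = fderiv ℝ (fderiv ℝ u) x l k :=
    fun x hx => ((hu.contDiffOn.contDiffAt (hΩo.mem_nhds hx)).isSymmSndFDerivAt (by simp)).eq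
  have hVsymm : ∀ x k l, fderiv ℝ (fderiv ℝ V) x k l = fderiv ℝ (fderiv ℝ V) x l k :=
    fun x k l => second_derivative_symmetric (fun y => (hV y).hasFDerivAt) (hV2 x).hasFDerivAt k l
  set T := ∫⁻ x in K, traceInv (hessianMatrix u x) (hessianMatrix V x) ∂(expMeasure V) with hT
  -- The limit of the left-hand sides, one coordinate at a time.
  have ha : ∀ i, IntegrableOn (fun x => Real.exp (-V x) * fderiv ℝ u x (e i) ^ 2) Ω := fun i =>
    (hK.integrableOn_expMeasure_iff hVc).1 (integrableOn_fderiv_sq hu i)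
  have hc : ∀ i, IntegrableOn (fun x => Real.exp (-V x) *
      fderiv ℝ (fderiv ℝ u) x (e i) (e i)) Ω := fun i =>
    (hK.integrableOn_expMeasure_iff hVc).1 (integrableOn_fderiv_fderiv hK hVc hu i)
  have hd : ∀ i, IntegrableOn (fun x => Real.exp (-V x) *
      fderiv ℝ (fderiv ℝ V) x (e i) (e i)) Ω := fun i =>
    (integrableOn_fderiv_fderiv_of_isBounded hV2 (fun x => hnn x _) hΩb).continuous_mul_of_isBounded
      (by fun_prop) hΩm hΩb
  have hlim := tendsto_finsetSum Finset.univ fun i _ =>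
    tendsto_integral_regularized hΩm hΩb (fun m => (hSo m).measurableSet) hSΩ hSt
      (fun m => (hε0 m).le) hε1 hεt hVc (e i) t (measurable_fderiv_apply_const ℝ u (e i)) (ha i)
      (by fun_prop : Continuous fun x => fderiv ℝ V x (e i))
      (measurable_fderiv_fderiv_apply u (e i) (e i)) (hc i)
      (measurable_fderiv_fderiv_apply V (e i) (e i)) (hd i)
  have hbound := le_of_tendsto' hlim (b := T.toReal) fun m => by
    have hBL := fun i => integrable_and_integral_le_regularizedDualForm (hSo m)
      (hK.convex.interior.smul (r m)) (hSneg m) (hK.isCompact.smul (r m)) (hK.convex.smul (r m))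
      (hSK m) hΩo (hK.smul_subset_interior (hr0 m).le (hr1 m)) hVconvex hVeven hV hV2
      hu.contDiffOn (fun x hx => hueven x (interior_subset (hSΩ m hx))) (hε0 m) t (e i)
    refine (Finset.sum_le_sum fun i _ => (hBL i).2).trans ?_
    rw [← integral_finsetSum _ fun i _ => (hBL i).1]
    refine (integral_le_toReal_lintegral_ofReal
      (integrable_finsetSum _ fun i _ => (hBL i).1)).trans (ENNReal.toReal_mono hfin ?_)
    rw [hT, hK.setLIntegral_expMeasure hVc]
    refine (setLIntegral_mono' (hSo m).measurableSet fun x hx => ?_).trans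
      (lintegral_mono_set (hSΩ m))
    rw [← Finset.mul_sum, ENNReal.ofReal_mul (Real.exp_pos _).le]
    refine mul_le_mul' (ENNReal.ofReal_le_ofReal (Real.exp_le_exp.2 ?_))
      (ofReal_sum_regularizedDualForm_le_traceInv (hε0 m).le (hnn x) (hVsymm x)
        (hu2 x (hSΩ m hx)) (husymm x (hSΩ m hx)))
    have h1 : 0 ≤ ε m / 2 * ‖x‖ ^ 2 := by have := hε0 m; positivity
    linarith
  refine le_trans (le_of_eq ?_) hbound
  have i1 : IntegrableOn (fun x => ‖gradient u x‖ ^ 2) K (expMeasure V) := by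
    simp_rw [norm_gradient_sq]
    exact integrable_finsetSum _ fun i _ => integrableOn_fderiv_sq hu i
  have i2 := integrableOn_opL hK hV hV2 hu
  have i3 := integrableOn_opL_self hK hVconvex hV hV2
  have i4 := i1.add (i2.const_mul (2 * t))
  simp only [Pi.add_def] at i4
  rw [← integral_const_mul, ← integral_const_mul, ← integral_add i1 (i2.const_mul _),
    ← integral_sub i4 (i3.const_mul _), hK.setIntegral_expMeasure hVc, ← integral_finsetSum]
  · refine integral_congr_ae (.of_forall fun x => ?_)
    simp only [norm_gradient_sq, opL_eq_sum]
    rw [Finset.mul_sum, Finset.mul_sum, ← Finset.sum_add_distrib, ← Finset.sum_sub_distrib,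
      Finset.mul_sum]
    refine Finset.sum_congr rfl fun i _ => ?_
    simp only [he]
    ring
  · intro i _
    have hab : IntegrableOn (fun x => Real.exp (-V x) *
        (fderiv ℝ u x (e i) * fderiv ℝ V x (e i))) Ω := by
      have h0 : IntegrableOn (fun x => Real.exp (-V x) * fderiv ℝ u x (e i)) Ω := by
        have : IsFiniteMeasure ((expMeasure V).restrict K) :=
          ⟨by rw [Measure.restrict_apply_univ]; exact (hK.expMeasure_ne_top hVc).lt_top⟩
        exact (hK.integrableOn_expMeasure_iff hVc).1 (((memLp_two_iff_integrable_sq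
          (measurable_fderiv_apply_const ℝ u _).aestronglyMeasurable).2
            (integrableOn_fderiv_sq hu i)).integrable one_le_two)
      refine (h0.continuous_mul_of_isBounded
        (by fun_prop : Continuous fun x => fderiv ℝ V x (e i)) hΩm hΩb).congr
        (.of_forall fun x => ?_)
      simp only
      ring
    have hbb : IntegrableOn (fun x => Real.exp (-V x) * fderiv ℝ V x (e i) ^ 2) Ω :=
      integrableOn_of_continuous_of_isBounded (by fun_prop) hΩb
    refine (((((ha i).sub (hab.const_mul (2 * t))).add (hbb.const_mul (t ^ 2))).add
      ((hc i).const_mul (2 * t))).sub ((hd i).const_mul (t ^ 2))).congr (.of_forall fun x => ?_)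
    simp only [Pi.sub_apply, Pi.add_apply]
    ring

theorem memW22C2_zero (μ : Measure (Rn n)) : MemW22C2 K μ (fun _ => (0 : ℝ)) where
  contDiffOn := contDiffOn_const
  memLp := MemLp.zero'
  memLp_gradient := by
    have h : gradient (fun _ : Rn n => (0 : ℝ)) = fun _ => 0 := by
      funext x
      simp [gradient]
    rw [h]
    exact MemLp.zero'
  memLp_hessian i j := by
    have h : (fun x => hessianMatrix (fun _ : Rn n => (0 : ℝ)) x i j) = fun _ => 0 := by
      funext x
      simp [hessianMatrix_apply]
    rw [h]
    exact MemLp.zero'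

theorem hessianMatrix_zero (x : Rn n) : hessianMatrix (fun _ : Rn n => (0 : ℝ)) x = 0 := by
  ext i j
  simp [hessianMatrix_apply]

theorem traceInv_zero (A : Matrix (Fin n) (Fin n) ℝ) : traceInv 0 A = 0 :=
  le_antisymm (iInf₂_le_of_le 0 (Matrix.mul_zero A) (by simp)) zero_le

/-- The case `u = 0`, `t = 1` of the quadratic inequality. -/
theorem setIntegral_opL_self_nonneg (hK : IsSymmConvexBody K) (hVconvex : ConvexOn ℝ univ V)
    (hVeven : ∀ x, V (-x) = V x) (hV : Differentiable ℝ V)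
    (hV2 : Differentiable ℝ (fderiv ℝ V)) :
    0 ≤ ∫ x in K, opL V V x ∂(expMeasure V) := by
  have h := integral_le_lintegral_traceInv hK hVconvex hVeven hV hV2
    (memW22C2_zero (K := K) (expMeasure V)) (fun _ _ => rfl)
    (by simp [hessianMatrix_zero, traceInv_zero]) 1
  have e1 : ∀ x, opL V (fun _ : Rn n => (0 : ℝ)) x = 0 := fun x => by simp [opL_eq_sum]
  have e2 : ∀ x, gradient (fun _ : Rn n => (0 : ℝ)) x = 0 := fun x => by simp [gradient]
  simp [hessianMatrix_zero, traceInv_zero, e1, e2] at h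
  exact h

/-- Optimization of a quadratic inequality in `t`, with the conventions of `[0, ∞]` for a vanishing
denominator. -/
theorem ofReal_add_div_le_of_forall {a b c T : ℝ} (ha : 0 ≤ a) (hc : 0 ≤ c)
    (h : ∀ t : ℝ, a + 2 * t * b - t ^ 2 * c ≤ T) :
    ENNReal.ofReal a + ENNReal.ofReal (b ^ 2) / ENNReal.ofReal c ≤ ENNReal.ofReal T := by
  rcases hc.eq_or_lt with rfl | hc
  · have hb : b = 0 := by
      by_contra hb
      have := h ((T - a + 1) / (2 * b))
      have e : 2 * ((T - a + 1) / (2 * b)) * b = T - a + 1 := by field_simp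
      linarith
    have := h 0
    simp [hb]
    exact ENNReal.ofReal_le_ofReal (by simpa using this)
  · rw [← ENNReal.ofReal_div_of_pos hc, ← ENNReal.ofReal_add ha (by positivity)]
    refine ENNReal.ofReal_le_ofReal ((le_of_eq ?_).trans (h (b / c)))
    field_simp
    ring

end QuadraticInequality

/-- Averages are taken over `K` with respect to `dμ = e^{-V} dx`. The inequality is one in `[0, ∞]`,
where `a / 0 = ∞` for `a > 0` and `0 / 0 = 0`; the first three assertions say that the averages of
`Lu` and `LV` are those of integrable functions and that the denominator is nonnegative. -/
theorem proposition5p1 {n : ℕ} (K : Set (Rn n)) (hK : IsSymmConvexBody K)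
    (V : Rn n → ℝ) (hVconvex : ConvexOn ℝ univ V) (hVeven : ∀ x, V (-x) = V x)
    (hVdiff : Differentiable ℝ V) (hVdiff2 : Differentiable ℝ (fderiv ℝ V))
    (u : Rn n → ℝ) (hu : MemW22C2 K (expMeasure V) u) (hueven : ∀ x ∈ K, u (-x) = u x) :
    IntegrableOn (opL V u) K (expMeasure V) ∧
    IntegrableOn (opL V V) K (expMeasure V) ∧
    0 ≤ ⨍ x in K, opL V V x ∂(expMeasure V) ∧
    ENNReal.ofReal (⨍ x in K, ‖gradient u x‖ ^ 2 ∂(expMeasure V)) +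
        ENNReal.ofReal ((⨍ x in K, opL V u x ∂(expMeasure V)) ^ 2) /
          ENNReal.ofReal (⨍ x in K, opL V V x ∂(expMeasure V)) ≤
      ⨍⁻ x in K, traceInv (hessianMatrix u x) (hessianMatrix V x) ∂(expMeasure V) := by
  have hVc := hVdiff.continuous
  have hμ0 := hK.expMeasure_ne_zero hVc
  have hμt := hK.expMeasure_ne_top hVc
  set μ := expMeasure V with hμ
  have hm : 0 < μ.real K := ENNReal.toReal_pos hμ0 hμt
  have hLV : 0 ≤ ⨍ x in K, opL V V x ∂μ := by
    rw [setAverage_eq, smul_eq_mul]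
    exact mul_nonneg (inv_nonneg.2 hm.le)
      (setIntegral_opL_self_nonneg hK hVconvex hVeven hVdiff hVdiff2)
  refine ⟨integrableOn_opL hK hVdiff hVdiff2 hu, integrableOn_opL_self hK hVconvex hVdiff hVdiff2,
    hLV, ?_⟩
  by_cases hfin : ∫⁻ x in K, traceInv (hessianMatrix u x) (hessianMatrix V x) ∂μ = ∞
  · rw [setLAverage_eq, hfin, ENNReal.top_div_of_ne_top hμt]
    exact le_top
  · set T := ∫⁻ x in K, traceInv (hessianMatrix u x) (hessianMatrix V x) ∂μ with hT
    have hTavg : ⨍⁻ x in K, traceInv (hessianMatrix u x) (hessianMatrix V x) ∂μ =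
        ENNReal.ofReal ((μ.real K)⁻¹ * T.toReal) := by
      rw [setLAverage_eq, ← hT, ENNReal.ofReal_mul (inv_nonneg.2 hm.le), ENNReal.ofReal_toReal hfin,
        ENNReal.ofReal_inv_of_pos hm, Measure.real, ENNReal.ofReal_toReal hμt, div_eq_mul_inv,
        mul_comm]
    rw [hTavg]
    refine ofReal_add_div_le_of_forall ?_ hLV fun t => ?_
    · rw [setAverage_eq, smul_eq_mul]
      exact mul_nonneg (inv_nonneg.2 hm.le) (integral_nonneg fun x => sq_nonneg _)
    · have h := integral_le_lintegral_traceInv hK hVconvex hVeven hVdiff hVdiff2 hu hueven hfin t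
      have h2 := mul_le_mul_of_nonneg_left h (inv_nonneg.2 hm.le)
      rw [setAverage_eq, setAverage_eq, setAverage_eq, smul_eq_mul, smul_eq_mul, smul_eq_mul]
      linarith
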